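/- **Theorem (Two-sided exit of a random walk).** For a real random variable $X$ with law $P_X$ put $X^+=\max\{0,X\}$ and $$\eta_0^+(P_X)=\sup_{x\ge 0}\mathbb E[X-x\mid X\ge x],\qquad \eta_0^-(P_X)=\sup_{x\ge 0}\mathbb E[-(X+x)\mid X<-x],$$ where the suprema, with values in $[0,\infty]$, run over the $x\ge 0$ for which the conditioning event has positive probability. If $\mathbb E[X]>0$ and $\mathbb E|X|^3<\infty$, put $$\eta(P_X)=\min\left\{\frac{\mathbb E[(X^+)^2]}{\mathbb E[X]},\ \frac{3\,\mathbb E|X|^3}{\mathbb E[X^2]},\ \eta_0^+(P_X)\right\}.$$ Let $X_1,X_2,\dots$ be i.i.d. real random variables on a probability space $(\Omega,\mathcal F,\mathbb P)$ with $X_1$ integrable, $\mathbb E[X_1]>0$ and $\mathbb P[X_1<0]>0$. Let $S_0=0$, $S_n=\sum_{k=1}^n X_k$, let $A\ge 0$, $B\ge 0$, and let $\tau=\inf\{n\ge 1: S_n\notin[-B,A]\}$ (with $\inf\emptyset=\infty$). Let $\mathcal E_+=\{\tau<\infty,\ S_\tau>A\}$, $\mathcal E_-=\{\tau<\infty,\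 S_\tau<-B\}$, $D_+=S_\tau-A$ on $\mathcal E_+$, $D_-=-(S_\tau+B)$ on $\mathcal E_-$, and $p_\pm=\mathbb P[\mathcal E_\pm]$. (i) If $\mathbb E|X_1|^3<\infty$, then $p_+>0$, $$\mathbb E[D_+\mid\mathcal E_+]\le\frac{\eta(P_{X_1})}{p_+}\qquad\text{and}\qquad \mathbb E[D_+\mid\mathcal E_+]\le\eta_0^+(P_{X_1}).$$ (ii) Let $\lambda>0$ satisfy $\mathbb E[e^{-\lambda X_1}]=1$. Let $\bar X_1$ be a random variable whose law has density $e^{-\lambda x}$ with respect to $P_{X_1}$, and let $\bar{\mathbb P}$ be the tilted measure, whose density with respect to $\mathbb P$ on $\mathcal F_n=\sigma(X_1,\dots,X_n)$ is $e^{-\lambda S_n}$ for every $n$ (realized on the space of increment sequences; equivalently, under $\bar{\mathbb P}$ the increments are i.i.d. with the law of $\bar X_1$). Let $\bar p_-=\bar{\mathbb P}[\mathcal E_-]$. If $\mathbb E|\bar X_1|^3<\infty$ and $\bar p_->0$, then $p_->0$, $$\mathbb E[D_-\mid\mathcal E_-]\le\frac{\eta(P_{-\bar X_1})}{\bar p_-}\qquad\text{and}\qquad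 \mathbb E[D_-\mid\mathcal E_-]\le\eta_0^-(P_{X_1}).$$ -/

import Mathlib

open MeasureTheory ProbabilityTheory
open scoped ENNReal

noncomputable section

namespace TwoSidedExit

/-! ### Overshoot parameters of a law on the real line -/

/-- `η₀⁺(ν) = sup_{x ≥ 0} E[X - x | X ≥ x]` for `X ∼ ν`, with values in `[0, ∞]`.
Levels `x` with `ν [x, ∞) = 0` contribute `0` (conditioning on a null event gives the zero
measure), so the supremum runs over the levels at which the conditioning makes sense. -/
def posMeanExcess (ν : Measure ℝ) : ℝ≥0∞ :=
  ⨆ (x : ℝ) (_ : 0 ≤ x), ∫⁻ y, ENNReal.ofReal (y - x) ∂(ν[|Set.Ici x])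

/-- `η₀⁻(ν) = sup_{x ≥ 0} E[-(X + x) | X < -x]` for `X ∼ ν`, with values in `[0, ∞]`. -/
def negMeanExcess (ν : Measure ℝ) : ℝ≥0∞ :=
  ⨆ (x : ℝ) (_ : 0 ≤ x), ∫⁻ y, ENNReal.ofReal (-(y + x)) ∂(ν[|Set.Iio (-x)])

/-- `η(ν) = min {E[(X⁺)²] / E[X], 3 E|X|³ / E[X²], η₀⁺(ν)}` for `X ∼ ν`; meant for laws with
positive mean and finite third absolute moment, for which no quotient is degenerate. -/
def overshootParam (ν : Measure ℝ) : ℝ≥0∞ :=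
  min (min
      ((∫⁻ y, ENNReal.ofReal ((max 0 y) ^ 2) ∂ν) / ENNReal.ofReal (∫ y, y ∂ν))
      (3 * (∫⁻ y, ENNReal.ofReal (|y| ^ 3) ∂ν) / ∫⁻ y, ENNReal.ofReal (y ^ 2) ∂ν))
    (posMeanExcess ν)

/-! ### The walk and its exit from `[-B, A]`

The increments `X₁, X₂, …` are indexed from `0`: `X k` is the `(k + 1)`-st increment. -/

variable {Ω : Type*}

/-- `S n = X₁ + ⋯ + Xₙ`, with `S 0 = 0`. -/
def walk (X : ℕ → Ω → ℝ) (n : ℕ) (ω : Ω) : ℝ := ∑ k ∈ Finset.range n, X k ω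

/-- `τ = inf {n ≥ 1 : S n ∉ [-B, A]}`, with `inf ∅ = ∞`. -/
def exitTime (X : ℕ → Ω → ℝ) (A B : ℝ) : Ω → WithTop ℕ :=
  hittingAfter (walk X) (Set.Icc (-B) A)ᶜ 1

/-- `S_τ` (meaningful where `τ < ∞`). -/
def exitPosition (X : ℕ → Ω → ℝ) (A B : ℝ) : Ω → ℝ :=
  stoppedValue (walk X) (exitTime X A B)

/-- The event `τ < ∞`, `S_τ > A`. -/
def upperExit (X : ℕ → Ω → ℝ) (A B : ℝ) : Set Ω :=
  {ω | exitTime X A B ω ≠ ⊤ ∧ A < exitPosition X A B ω}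

/-- The event `τ < ∞`, `S_τ < -B`. -/
def lowerExit (X : ℕ → Ω → ℝ) (A B : ℝ) : Set Ω :=
  {ω | exitTime X A B ω ≠ ⊤ ∧ exitPosition X A B ω < -B}

/-- The upper overshoot `S_τ - A`. -/
def upperOvershoot (X : ℕ → Ω → ℝ) (A B : ℝ) (ω : Ω) : ℝ := exitPosition X A B ω - A

/-- The lower overshoot `-(S_τ + B)`. -/
def lowerOvershoot (X : ℕ → Ω → ℝ) (A B : ℝ) (ω : Ω) : ℝ := -(exitPosition X A B ω + B)

/-- `E[D | E] ∈ [0, ∞]` for a random variable `D` that is nonnegative on the event `E`. -/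
def condMean [MeasurableSpace Ω] (P : Measure Ω) (D : Ω → ℝ) (E : Set Ω) : ℝ≥0∞ :=
  ∫⁻ ω, ENNReal.ofReal (D ω) ∂(P[|E])

/-! ### Exponential tilting -/

/-- The law with density `e^{-λ x}` with respect to `ν`. -/
def tiltedLaw (ν : Measure ℝ) (lam : ℝ) : Measure ℝ :=
  ν.withDensity fun x => ENNReal.ofReal (Real.exp (-lam * x))

/-- The coordinate increments on the path space. -/
def coordIncr (k : ℕ) (x : ℕ → ℝ) : ℝ := x k

/-- The tilted measure on the space of increment sequences: the increments are i.i.d. with the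
tilted law. By `tiltedPathMeasure_apply` it is the measure whose density with respect to
the original path law is `e^{-λ S n}` on the σ-algebra of the first `n` increments. -/
def tiltedPathMeasure (ν : Measure ℝ) (lam : ℝ) : Measure (ℕ → ℝ) :=
  Measure.infinitePi fun _ => tiltedLaw ν lam

theorem tiltedPathMeasure_apply (ν : Measure ℝ) [IsProbabilityMeasure ν] (lam : ℝ)
    (h : ∫ x, Real.exp (-lam * x) ∂ν = 1) (n : ℕ) (s : Set (ℕ → ℝ))
    (hs : MeasurableSet[cylinderEvents (X := fun _ : ℕ => ℝ) (Finset.range n : Set ℕ)] s) :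
    tiltedPathMeasure ν lam s =
      ∫⁻ x in s, ENNReal.ofReal (Real.exp (-lam * walk coordIncr n x))
        ∂(Measure.infinitePi fun _ => ν) := by
  have hprob : IsProbabilityMeasure (tiltedLaw ν lam) := by
    constructor
    rw [tiltedLaw, withDensity_apply _ MeasurableSet.univ, Measure.restrict_univ,
      ← ofReal_integral_eq_lintegral_ofReal (integrable_of_integral_eq_one h)
        (Filter.Eventually.of_forall fun x => (Real.exp_pos _).le), h, ENNReal.ofReal_one]
  have hcyl : ∃ t : Set ((Finset.range n) → ℝ), MeasurableSet t ∧
      (Finset.range n).restrict ⁻¹' t = s := by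
    have hle : cylinderEvents (X := fun _ : ℕ => ℝ) (Finset.range n : Set ℕ) ≤
        MeasurableSpace.comap ((Finset.range n).restrict (π := fun _ => ℝ))
          MeasurableSpace.pi := by
      refine iSup₂_le fun i hi => ?_
      have : (fun x : ℕ → ℝ => x i) = (fun y : (Finset.range n) → ℝ => y ⟨i, hi⟩) ∘
          (Finset.range n).restrict (π := fun _ => ℝ) := rfl
      rw [this, ← MeasurableSpace.comap_comp]
      exact MeasurableSpace.comap_mono (measurable_pi_apply _).comap_le
    exact hle s hs
  obtain ⟨t, ht, rfl⟩ := hcyl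
  have hwalk : Measurable fun x : ℕ → ℝ =>
      ENNReal.ofReal (Real.exp (-lam * walk coordIncr n x)) := by
    unfold walk coordIncr
    fun_prop
  have hr : Measurable ((Finset.range n).restrict (π := fun _ => ℝ)) :=
    Finset.measurable_restrict _
  have key : Measure.pi (fun _ : Finset.range n => tiltedLaw ν lam) =
      ((Measure.infinitePi fun _ : ℕ => ν).withDensity fun x =>
        ENNReal.ofReal (Real.exp (-lam * walk coordIncr n x))).map (Finset.range n).restrict := by
    refine Measure.pi_eq fun u hu => ?_
    rw [Measure.map_apply hr (.univ_pi hu), withDensity_apply _ (hr (.univ_pi hu)),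
      ← lintegral_indicator (hr (.univ_pi hu))]
    have hprod : ∀ x : ℕ → ℝ,
        ((Finset.range n).restrict ⁻¹' Set.univ.pi u).indicator
          (fun x => ENNReal.ofReal (Real.exp (-lam * walk coordIncr n x))) x =
        ∏ i : Finset.range n,
          (u i).indicator (fun y => ENNReal.ofReal (Real.exp (-lam * y))) (x i) := by
      intro x
      by_cases hx : x ∈ (Finset.range n).restrict ⁻¹' Set.univ.pi u
      · have hx' : ∀ i : Finset.range n, x i ∈ u i := fun i => hx i (Set.mem_univ i)
        rw [Set.indicator_of_mem hx]
        simp only [Set.indicator_of_mem (hx' _)]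
        rw [← ENNReal.ofReal_prod_of_nonneg fun _ _ => (Real.exp_pos _).le, ← Real.exp_sum,
          ← Finset.mul_sum, Finset.sum_coe_sort (Finset.range n) (fun i => x i)]
        rfl
      · rw [Set.indicator_of_notMem hx]
        have : ∃ i : Finset.range n, x i ∉ u i := by
          by_contra hcon
          push Not at hcon
          exact hx fun i _ => hcon i
        obtain ⟨i, hi⟩ := this
        exact (Finset.prod_eq_zero (Finset.mem_univ i) (Set.indicator_of_notMem hi _)).symm
    simp_rw [hprod]
    have hg : ∀ i : Finset.range n, Measurable
        ((u i).indicator (fun y => ENNReal.ofReal (Real.exp (-lam * y)))) := fun i =>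
      Measurable.indicator (by fun_prop) (hu i)
    have hint := lintegral_restrict_infinitePi (μ := fun _ : ℕ => ν) (s := Finset.range n)
      (f := fun y => ∏ i, (u i).indicator (fun y => ENNReal.ofReal (Real.exp (-lam * y))) (y i))
      (Finset.measurable_prod _ fun i _ => (hg i).comp (measurable_pi_apply i))
    refine hint.trans ?_
    rw [lintegral_prod_eq_prod_lintegral_of_indepFun Finset.univ
      (fun (i : Finset.range n) (y : (Finset.range n) → ℝ) =>
        (u i).indicator (fun y => ENNReal.ofReal (Real.exp (-lam * y))) (y i))
      (iIndepFun_pi (μ := fun _ : Finset.range n => ν) fun i => (hg i).aemeasurable)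
      (fun i => (hg i).comp (measurable_pi_apply i))]
    refine Finset.prod_congr rfl fun i _ => ?_
    rw [tiltedLaw, withDensity_apply _ (hu i), ← lintegral_indicator (hu i)]
    exact (measurePreserving_eval (fun _ : Finset.range n => ν) i).lintegral_comp (hg i)
  rw [tiltedPathMeasure, ← Measure.map_apply hr ht, Measure.infinitePi_map_restrict, key,
    Measure.map_apply hr ht, withDensity_apply _ (hr ht)]

end TwoSidedExit

end

noncomputable section

namespace TwoSidedExit

/-! ### Killed walks, Green measures and exit laws -/

/-! Everything is expressed through the exit law of a set, a measure on the line that depends only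
on the step law `ν`; `setLIntegral_exitPosition` transfers integrals over exit events to it.

The core is the bound E[D₊; E₊] ≤ η, where each term of η has its own source. On E₊ the exit is also
the first passage above A, so D₊ is an overshoot of the unrestricted walk, hence an overshoot over A
of the renewal process of strict ascending ladder heights H. Lorden's inequality
(`renewalOvershoot_mul_le`) bounds its mean by E H² / E H. That quotient is estimated in two ways.
If g is the expected time spent in (-∞, 0] before the first ladder epoch, then E H ≥ g E X by Wald
and E H² ≤ g E (X⁺)², which gives the first term (`ladder_sq_moment_mul_le`). The Wiener-Hopf
factorization compares second and third moments of X with those of the ladder heights and gives E H²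
/ E H ≤ 2 E|X|³ / E X², hence the second term (`IsWienerHopf.sq_moment_mul_le`). For the third term,
condition on the position x before the exit step: the overshoot is the excess of a single step over
A - x ≥ 0 (`lintegral_exitLaw_le_mul`). This last bound carries the factor p₊, so it survives
conditioning without a quotient.

For the lower exit, tilting multiplies the exit law by e^{-λx}. The overshoot and this density both
decrease in the exit position, so by Chebyshev's association inequality tilting can only increase
the conditional mean (`lintegral_lowerOvershoot_mul_le`). The tilted law has negative mean
(`integral_tiltedLaw_neg`), so after reflection the upper bound applies. -/

/-- The law of `S n` on the event `S 1, …, S n ∈ S`, for the walk with step law `ν`. -/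
def killedLaw (ν : Measure ℝ) (S : Set ℝ) : ℕ → Measure ℝ
  -- There is no restriction to `S` at time 0, so `S` may be (0, ∞) although the walk starts at 0.
  | 0 => Measure.dirac 0
  | n + 1 => (killedLaw ν S n ∗ ν).restrict S

/-- The law of `S (n + 1)` on the event that the walk leaves `S` at time `n + 1`. -/
def exitLawAt (ν : Measure ℝ) (S : Set ℝ) (n : ℕ) : Measure ℝ :=
  (killedLaw ν S n ∗ ν).restrict Sᶜ

/-- The expected occupation measure of the walk before it leaves `S`. -/
def greenLaw (ν : Measure ℝ) (S : Set ℝ) : Measure ℝ := Measure.sum (killedLaw ν S)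

/-- The law of the position at which the walk leaves `S`. -/
def exitLaw (ν : Measure ℝ) (S : Set ℝ) : Measure ℝ := Measure.sum (exitLawAt ν S)

instance (ν : Measure ℝ) [IsFiniteMeasure ν] (S : Set ℝ) (n : ℕ) :
    IsFiniteMeasure (killedLaw ν S n) := by
  induction n with
  | zero => unfold killedLaw; infer_instance
  | succ n ih => unfold killedLaw; infer_instance

instance (ν : Measure ℝ) [IsFiniteMeasure ν] (S : Set ℝ) (n : ℕ) :
    IsFiniteMeasure (exitLawAt ν S n) := by
  unfold exitLawAt; infer_instance

instance (ν : Measure ℝ) [IsFiniteMeasure ν] (S : Set ℝ) : SFinite (greenLaw ν S) := by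
  unfold greenLaw; infer_instance

instance (ν : Measure ℝ) [IsFiniteMeasure ν] (S : Set ℝ) : SFinite (exitLaw ν S) := by
  unfold exitLaw; infer_instance

theorem killedLaw_zero (ν : Measure ℝ) (S : Set ℝ) : killedLaw ν S 0 = Measure.dirac 0 := rfl

theorem killedLaw_succ (ν : Measure ℝ) (S : Set ℝ) (n : ℕ) :
    killedLaw ν S (n + 1) = (killedLaw ν S n ∗ ν).restrict S := rfl

theorem killedLaw_succ_add_exitLawAt (ν : Measure ℝ) {S : Set ℝ} (hS : MeasurableSet S) (n : ℕ) :
    killedLaw ν S (n + 1) + exitLawAt ν S n = killedLaw ν S n ∗ ν :=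
  Measure.restrict_add_restrict_compl hS

theorem sum_conv {ι : Type*} (μ : ι → Measure ℝ) (ν : Measure ℝ) [SFinite ν] :
    Measure.sum μ ∗ ν = Measure.sum fun i => μ i ∗ ν := by
  refine Measure.ext_of_lintegral _ fun f hf => ?_
  rw [Measure.lintegral_conv hf, lintegral_sum_measure, lintegral_sum_measure]
  simp_rw [Measure.lintegral_conv hf]

theorem sum_conv_sum (μ ν : ℕ → Measure ℝ) [∀ n, SFinite (μ n)] [∀ n, SFinite (ν n)] :
    Measure.sum μ ∗ Measure.sum ν = Measure.sum fun p : ℕ × ℕ => μ p.1 ∗ ν p.2 := by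
  refine Measure.ext_of_lintegral _ fun f hf => ?_
  rw [sum_conv, lintegral_sum_measure, lintegral_sum_measure, ENNReal.tsum_prod']
  refine tsum_congr fun i => ?_
  rw [Measure.conv_comm, sum_conv, lintegral_sum_measure]
  simp_rw [Measure.conv_comm (μ i)]

theorem greenLaw_eq_dirac_add (ν : Measure ℝ) (S : Set ℝ) :
    greenLaw ν S = Measure.dirac 0 + Measure.sum fun n => killedLaw ν S (n + 1) := by
  refine Measure.ext_of_lintegral _ fun f hf => ?_
  rw [greenLaw, lintegral_sum_measure, lintegral_add_measure, lintegral_sum_measure,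
    tsum_eq_zero_add' ENNReal.summable, killedLaw_zero]

/-- Every visit or exit except the start is one step away from an earlier visit. In Fourier terms
g(1 - ν) = 1 - e, which drives both the factorization and the mass count. -/
theorem greenLaw_add_exitLaw (ν : Measure ℝ) [IsFiniteMeasure ν] {S : Set ℝ}
    (hS : MeasurableSet S) :
    greenLaw ν S + exitLaw ν S = Measure.dirac 0 + greenLaw ν S ∗ ν := by
  conv_lhs => rw [greenLaw_eq_dirac_add]
  rw [add_assoc, exitLaw, Measure.sum_add_sum, greenLaw, sum_conv]
  simp_rw [killedLaw_succ_add_exitLawAt ν hS]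

theorem exitLaw_ae_notMem (ν : Measure ℝ) {S : Set ℝ} (hS : MeasurableSet S) :
    ∀ᵐ x ∂(exitLaw ν S), x ∉ S := by
  rw [exitLaw, Measure.ae_sum_iff' hS.compl]
  exact fun n => ae_restrict_mem hS.compl

theorem killedLaw_succ_ae_mem (ν : Measure ℝ) {S : Set ℝ} (hS : MeasurableSet S) (n : ℕ) :
    ∀ᵐ x ∂(killedLaw ν S (n + 1)), x ∈ S := ae_restrict_mem hS

theorem killedLaw_ae_mem (ν : Measure ℝ) {S : Set ℝ} (hS : MeasurableSet S) (h0 : (0 : ℝ) ∈ S)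
    (n : ℕ) : ∀ᵐ x ∂(killedLaw ν S n), x ∈ S := by
  cases n with
  | zero => exact (ae_dirac_iff hS).2 h0
  | succ n => exact killedLaw_succ_ae_mem ν hS n

theorem conv_univ (μ ν : Measure ℝ) [SFinite μ] [SFinite ν] :
    (μ ∗ ν) Set.univ = μ Set.univ * ν Set.univ := by
  rw [Measure.conv, Measure.map_apply (by fun_prop) MeasurableSet.univ, Set.preimage_univ,
    Measure.prod_apply MeasurableSet.univ]
  simp [mul_comm]

theorem killedLaw_univ_le (ν : Measure ℝ) [IsFiniteMeasure ν] (S : Set ℝ) (n : ℕ) :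
    killedLaw ν S n Set.univ ≤ ν Set.univ ^ n := by
  induction n with
  | zero => simp [killedLaw_zero]
  | succ n ih =>
    rw [killedLaw_succ, pow_succ]
    exact (Measure.restrict_apply_le _ _).trans (by rw [conv_univ]; gcongr)

/-- Mass below 1 means geometric killing. The factorization is proved first under this assumption,
where characteristic functions are available. -/
theorem isFiniteMeasure_greenLaw (ν : Measure ℝ) [IsFiniteMeasure ν] (h : ν Set.univ < 1)
    (S : Set ℝ) : IsFiniteMeasure (greenLaw ν S) := by
  constructor
  rw [greenLaw, Measure.sum_apply _ MeasurableSet.univ]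
  refine (ENNReal.tsum_le_tsum (killedLaw_univ_le ν S)).trans_lt ?_
  rw [ENNReal.tsum_geometric, ENNReal.inv_lt_top]
  exact tsub_pos_of_lt h

theorem exitLaw_le (ν : Measure ℝ) [IsFiniteMeasure ν] (S : Set ℝ) :
    exitLaw ν S ≤ greenLaw ν S ∗ ν := by
  rw [exitLaw, greenLaw, sum_conv]
  refine Measure.le_iff.2 fun s hs => ?_
  rw [Measure.sum_apply _ hs, Measure.sum_apply _ hs]
  exact ENNReal.tsum_le_tsum fun n => Measure.restrict_apply_le _ _

/-! ### The Wiener-Hopf factorization -/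

theorem charFun_add_measure (μ ν : Measure ℝ) [IsFiniteMeasure μ] [IsFiniteMeasure ν] (t : ℝ) :
    charFun (μ + ν) t = charFun μ t + charFun ν t := by
  have h (ρ : Measure ℝ) [IsFiniteMeasure ρ] :
      Integrable (fun x : ℝ => Complex.exp (t * x * Complex.I)) ρ := by
    refine (integrable_const (1 : ℝ)).mono' (by fun_prop) (ae_of_all _ fun x => ?_)
    rw [← Complex.ofReal_mul, Complex.norm_exp_ofReal_mul_I]
  simp_rw [charFun_apply_real]
  exact integral_add_measure (h μ) (h ν)

theorem charFun_greenLaw_add_exitLaw (ν : Measure ℝ) [IsFiniteMeasure ν] {S : Set ℝ}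
    (hS : MeasurableSet S) [IsFiniteMeasure (greenLaw ν S)] [IsFiniteMeasure (exitLaw ν S)]
    (t : ℝ) :
    charFun (greenLaw ν S) t + charFun (exitLaw ν S) t =
      1 + charFun (greenLaw ν S) t * charFun ν t := by
  have h := congrArg (fun μ => charFun μ t) (greenLaw_add_exitLaw ν hS)
  simpa [charFun_add_measure, charFun_conv] using h

theorem ae_conv {μ ν : Measure ℝ} [SFinite μ] [SFinite ν] {p : ℝ → Prop}
    (hp : MeasurableSet {x | p x}) (h : ∀ᵐ x ∂μ, ∀ᵐ y ∂ν, p (x + y)) : ∀ᵐ z ∂(μ ∗ ν), p z := by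
  rw [Measure.conv, ae_map_iff (by fun_prop) hp]
  exact (Measure.ae_prod_iff_ae_ae (hp.preimage (by fun_prop))).2 h

theorem greenLaw_ae_mem (ν : Measure ℝ) {S T : Set ℝ} (hS : MeasurableSet S)
    (hT : MeasurableSet T) (hST : S ⊆ T) (h0 : (0 : ℝ) ∈ T) : ∀ᵐ x ∂(greenLaw ν S), x ∈ T := by
  refine (Measure.ae_sum_iff' hT).2 fun n => ?_
  cases n with
  | zero => exact (ae_dirac_iff hT).2 h0
  | succ n => exact (killedLaw_succ_ae_mem ν hS n).mono fun x hx => hST hx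

/-- Write g₊, e₋ for the Green and exit laws of (0, ∞) and g₋, e₊ for those of (-∞, 0]. Eliminating
`ν` from g₊(1 - ν) = 1 - e₋ and g₋(1 - ν) = 1 - e₊ gives g₊e₊ + g₋ = g₊ + g₋e₋. On (0, ∞) the terms
g₋ and g₋e₋ vanish, and g₊ loses only its unit mass at 0. -/
theorem greenLaw_Ioi_eq (ν : Measure ℝ) [IsFiniteMeasure ν] (h : ν Set.univ < 1) :
    greenLaw ν (Set.Ioi 0) =
      Measure.dirac 0 + greenLaw ν (Set.Ioi 0) ∗ exitLaw ν (Set.Iic 0) := by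
  have hg (S : Set ℝ) := isFiniteMeasure_greenLaw ν h S
  have he (S : Set ℝ) : IsFiniteMeasure (exitLaw ν S) := isFiniteMeasure_of_le _ (exitLaw_le ν S)
  have key : greenLaw ν (Set.Ioi 0) ∗ exitLaw ν (Set.Iic 0) + greenLaw ν (Set.Iic 0) =
      greenLaw ν (Set.Ioi 0) + greenLaw ν (Set.Iic 0) ∗ exitLaw ν (Set.Ioi 0) := by
    refine Measure.ext_of_charFun (funext fun t => ?_)
    have h1 := charFun_greenLaw_add_exitLaw ν (S := Set.Ioi 0) measurableSet_Ioi t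
    have h2 := charFun_greenLaw_add_exitLaw ν (S := Set.Iic 0) measurableSet_Iic t
    simp only [charFun_add_measure, charFun_conv]
    linear_combination charFun (greenLaw ν (Set.Ioi 0)) t * h2 -
      charFun (greenLaw ν (Set.Iic 0)) t * h1
  have r1 : (greenLaw ν (Set.Ioi 0) ∗ exitLaw ν (Set.Iic 0)).restrict (Set.Ioi 0) =
      greenLaw ν (Set.Ioi 0) ∗ exitLaw ν (Set.Iic 0) := by
    refine Measure.restrict_eq_self_of_ae_mem (ae_conv measurableSet_Ioi ?_)
    filter_upwards [greenLaw_ae_mem ν (S := Set.Ioi 0) (T := Set.Ici 0) measurableSet_Ioi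
      measurableSet_Ici Set.Ioi_subset_Ici_self (Set.mem_Ici.2 le_rfl)] with x hx
    filter_upwards [exitLaw_ae_notMem ν (S := Set.Iic 0) measurableSet_Iic] with y hy
    simp only [Set.mem_Ici, Set.mem_Iic, Set.mem_Ioi, not_le] at *
    linarith
  have r2 : (greenLaw ν (Set.Iic 0)).restrict (Set.Ioi 0) = 0 := by
    rw [Measure.restrict_eq_zero, ← compl_mem_ae_iff]
    filter_upwards [greenLaw_ae_mem ν (S := Set.Iic 0) (T := Set.Iic 0) measurableSet_Iic
      measurableSet_Iic subset_rfl (Set.mem_Iic.2 le_rfl)] with x hx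
    simpa using hx
  have r3 : (greenLaw ν (Set.Iic 0) ∗ exitLaw ν (Set.Ioi 0)).restrict (Set.Ioi 0) = 0 := by
    rw [Measure.restrict_eq_zero, ← compl_mem_ae_iff]
    refine ae_conv measurableSet_Ioi.compl ?_
    filter_upwards [greenLaw_ae_mem ν (S := Set.Iic 0) (T := Set.Iic 0) measurableSet_Iic
      measurableSet_Iic subset_rfl (Set.mem_Iic.2 le_rfl)] with x hx
    filter_upwards [exitLaw_ae_notMem ν (S := Set.Ioi 0) measurableSet_Ioi] with y hy
    simp only [Set.mem_Iic, Set.mem_Ioi, not_lt] at *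
    linarith
  have r4 : (greenLaw ν (Set.Ioi 0)).restrict (Set.Ioi 0) =
      Measure.sum fun n => killedLaw ν (Set.Ioi 0) (n + 1) := by
    have hd : (Measure.dirac (0 : ℝ)).restrict (Set.Ioi 0) = 0 := by
      rw [Measure.restrict_eq_zero, Measure.dirac_apply' _ measurableSet_Ioi]; simp
    rw [greenLaw_eq_dirac_add, Measure.restrict_add, hd, zero_add]
    refine Measure.restrict_eq_self_of_ae_mem ((Measure.ae_sum_iff' measurableSet_Ioi).2 ?_)
    exact killedLaw_succ_ae_mem ν measurableSet_Ioi
  have := congrArg (fun μ => μ.restrict (Set.Ioi 0)) key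
  simp only [Measure.restrict_add, r1, r2, r3, r4, add_zero] at this
  rw [this, ← greenLaw_eq_dirac_add]

/-- Multiplying g₊(1 - ν) = 1 - e₋ by 1 - e₊ and using g₊(1 - e₊) = 1 yields 1 - ν = (1 - e₊)(1 -
e₋). -/
theorem exitLaw_add_exitLaw_of_lt_one (ν : Measure ℝ) [IsFiniteMeasure ν] (h : ν Set.univ < 1) :
    exitLaw ν (Set.Iic 0) + exitLaw ν (Set.Ioi 0) =
      ν + exitLaw ν (Set.Iic 0) ∗ exitLaw ν (Set.Ioi 0) := by
  have hg (S : Set ℝ) := isFiniteMeasure_greenLaw ν h S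
  have : IsFiniteMeasure (exitLaw ν (Set.Iic 0)) :=
    isFiniteMeasure_of_le _ (exitLaw_le ν _)
  have : IsFiniteMeasure (exitLaw ν (Set.Ioi 0)) :=
    isFiniteMeasure_of_le _ (exitLaw_le ν _)
  refine Measure.ext_of_charFun (funext fun t => ?_)
  have h1 := charFun_greenLaw_add_exitLaw ν (S := Set.Ioi 0) measurableSet_Ioi t
  have h2 := congrArg (fun μ => charFun μ t) (greenLaw_Ioi_eq ν h)
  simp only [charFun_add_measure, charFun_conv, charFun_dirac] at h2 ⊢
  simp only [inner_zero_left, Complex.ofReal_zero, zero_mul, Complex.exp_zero] at h2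
  linear_combination (1 - charFun (exitLaw ν (Set.Iic 0)) t) * h1 -
    (1 - charFun ν t) * h2

theorem killedLaw_smul (ν : Measure ℝ) [IsFiniteMeasure ν] (s : ℝ≥0∞) (S : Set ℝ) (n : ℕ) :
    killedLaw (s • ν) S n = s ^ n • killedLaw ν S n := by
  induction n with
  | zero => simp [killedLaw_zero]
  | succ n ih =>
    rw [killedLaw_succ, killedLaw_succ, ih, Measure.conv_smul_left, Measure.conv_smul_right,
      smul_smul, Measure.restrict_smul, pow_succ]

theorem exitLawAt_smul (ν : Measure ℝ) [IsFiniteMeasure ν] (s : ℝ≥0∞) (S : Set ℝ) (n : ℕ) :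
    exitLawAt (s • ν) S n = s ^ (n + 1) • exitLawAt ν S n := by
  rw [exitLawAt, exitLawAt, killedLaw_smul, Measure.conv_smul_left, Measure.conv_smul_right,
    smul_smul, Measure.restrict_smul, pow_succ]

/-- An Abel limit: the sum is at most its value at 1, and finite partial sums converge, so infinite
totals are allowed. It carries the factorization from `s • ν` with s < 1 to `ν`, whose Green
measures may be infinite. -/
theorem tendsto_tsum_pow_mul {ι : Type*} (e : ι → ℕ) (c : ι → ℝ≥0∞) :
    Filter.Tendsto (fun s : ℝ≥0∞ => ∑' i, s ^ e i * c i) (nhdsWithin 1 (Set.Iio 1))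
      (nhds (∑' i, c i)) := by
  have hle : ∀ᶠ s : ℝ≥0∞ in nhdsWithin 1 (Set.Iio 1), ∑' i, s ^ e i * c i ≤ ∑' i, c i := by
    filter_upwards [self_mem_nhdsWithin] with s hs
    refine ENNReal.tsum_le_tsum fun i => ?_
    exact mul_le_of_le_one_left' (pow_le_one' (le_of_lt hs) _)
  refine tendsto_order.2 ⟨fun a ha => ?_, fun a ha => hle.mono fun s hs => hs.trans_lt ha⟩
  rw [ENNReal.tsum_eq_iSup_sum, lt_iSup_iff] at ha
  obtain ⟨F, hF⟩ := ha
  have ht : Filter.Tendsto (fun s : ℝ≥0∞ => ∑ i ∈ F, s ^ e i * c i) (nhdsWithin 1 (Set.Iio 1))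
      (nhds (∑ i ∈ F, c i)) := by
    refine tendsto_finsetSum _ fun i _ => ?_
    have h1 : Filter.Tendsto (fun s : ℝ≥0∞ => s ^ e i) (nhdsWithin 1 (Set.Iio 1)) (nhds 1) := by
      have := ((ENNReal.continuous_pow (e i)).tendsto 1)
      rw [one_pow] at this
      exact this.mono_left nhdsWithin_le_nhds
    simpa using ENNReal.Tendsto.mul_const h1 (Or.inl one_ne_zero) (b := c i)
  filter_upwards [(tendsto_order.1 ht).1 a hF] with s hs
  exact hs.trans_le (ENNReal.sum_le_tsum F)

theorem lintegral_exitLaw_smul (ν : Measure ℝ) [IsFiniteMeasure ν] (s : ℝ≥0∞) (S : Set ℝ)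
    (f : ℝ → ℝ≥0∞) :
    ∫⁻ x, f x ∂(exitLaw (s • ν) S) = ∑' n, s ^ (n + 1) * ∫⁻ x, f x ∂(exitLawAt ν S n) := by
  rw [exitLaw, lintegral_sum_measure]
  simp_rw [exitLawAt_smul, lintegral_smul_measure, smul_eq_mul]

theorem lintegral_exitLaw_smul_conv (ν : Measure ℝ) [IsFiniteMeasure ν] (s : ℝ≥0∞)
    (S T : Set ℝ) {f : ℝ → ℝ≥0∞} (hf : Measurable f) :
    ∫⁻ x, f x ∂(exitLaw (s • ν) S ∗ exitLaw (s • ν) T) =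
      ∑' p : ℕ × ℕ, s ^ (p.1 + 1 + (p.2 + 1)) *
        ∫⁻ x, f x ∂(exitLawAt ν S p.1 ∗ exitLawAt ν T p.2) := by
  -- Here `s` may be `∞` and `s • ν` need not be finite; this form shows that the exit law is still
  -- s-finite.
  have hs (S : Set ℝ) : exitLaw (s • ν) S = s • Measure.sum fun n => s ^ n • exitLawAt ν S n := by
    refine Measure.ext_of_lintegral _ fun g hg => ?_
    rw [lintegral_exitLaw_smul, lintegral_smul_measure, lintegral_sum_measure, smul_eq_mul,
      ← ENNReal.tsum_mul_left]
    refine tsum_congr fun n => ?_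
    rw [lintegral_smul_measure, pow_succ', mul_assoc, smul_eq_mul]
  have hsf (S : Set ℝ) : SFinite (exitLaw (s • ν) S) := by rw [hs]; infer_instance
  rw [Measure.lintegral_conv hf, lintegral_exitLaw_smul, ENNReal.tsum_prod']
  refine tsum_congr fun i => ?_
  simp_rw [lintegral_exitLaw_smul]
  rw [lintegral_tsum fun n => by
    exact (Measurable.const_mul (by fun_prop) _).aemeasurable, ← ENNReal.tsum_mul_left]
  refine tsum_congr fun j => ?_
  rw [lintegral_const_mul _ (by fun_prop), ← mul_assoc, ← pow_add, Measure.lintegral_conv hf]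

/-- The Wiener-Hopf factorization `ν = F₊ + F₋ - F₊ ∗ F₋`, where `F₊` and `F₋` are the laws of the
first strict ascending and the first weak descending ladder height. -/
theorem lintegral_exitLaw_add_exitLaw (ν : Measure ℝ) [IsProbabilityMeasure ν] {f : ℝ → ℝ≥0∞}
    (hf : Measurable f) :
    ∫⁻ x, f x ∂(exitLaw ν (Set.Iic 0)) + ∫⁻ x, f x ∂(exitLaw ν (Set.Ioi 0)) =
      ∫⁻ x, f x ∂ν + ∫⁻ x, f x ∂(exitLaw ν (Set.Iic 0) ∗ exitLaw ν (Set.Ioi 0)) := by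
  have : (nhdsWithin (1 : ℝ≥0∞) (Set.Iio 1)).NeBot :=
    nhdsLT_neBot_of_exists_lt ⟨0, one_pos⟩
  let C (p : ℕ × ℕ) : ℝ≥0∞ :=
    ∫⁻ x, f x ∂(exitLawAt ν (Set.Iic 0) p.1 ∗ exitLawAt ν (Set.Ioi 0) p.2)
  have hl (S : Set ℝ) : Filter.Tendsto (fun s : ℝ≥0∞ => ∫⁻ x, f x ∂(exitLaw (s • ν) S))
      (nhdsWithin 1 (Set.Iio 1)) (nhds (∫⁻ x, f x ∂(exitLaw ν S))) := by
    simp_rw [lintegral_exitLaw_smul]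
    rw [exitLaw, lintegral_sum_measure]
    exact tendsto_tsum_pow_mul _ _
  have hν : Filter.Tendsto (fun s : ℝ≥0∞ => ∫⁻ x, f x ∂(s • ν))
      (nhdsWithin 1 (Set.Iio 1)) (nhds (∫⁻ x, f x ∂ν)) := by
    simpa using tendsto_tsum_pow_mul (fun _ : Unit => 1) (fun _ => ∫⁻ x, f x ∂ν)
  have hc : Filter.Tendsto
      (fun s : ℝ≥0∞ => ∫⁻ x, f x ∂(exitLaw (s • ν) (Set.Iic 0) ∗ exitLaw (s • ν) (Set.Ioi 0)))
      (nhdsWithin 1 (Set.Iio 1))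
      (nhds (∫⁻ x, f x ∂(exitLaw ν (Set.Iic 0) ∗ exitLaw ν (Set.Ioi 0)))) := by
    have h2 : ∫⁻ x, f x ∂(exitLaw ν (Set.Iic 0) ∗ exitLaw ν (Set.Ioi 0)) = ∑' p, C p := by
      rw [exitLaw, exitLaw, sum_conv_sum, lintegral_sum_measure]
    simp_rw [lintegral_exitLaw_smul_conv ν _ _ _ hf, h2]
    exact tendsto_tsum_pow_mul _ _
  refine tendsto_nhds_unique ((hl _).add (hl _)) ((hν.add hc).congr' ?_)
  filter_upwards [self_mem_nhdsWithin] with s hs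
  have hs' : (s • ν) Set.univ < 1 := by simpa using hs
  have : IsFiniteMeasure (s • ν) := ⟨hs'.trans ENNReal.one_lt_top⟩
  have := congrArg (fun μ => ∫⁻ x, f x ∂μ) (exitLaw_add_exitLaw_of_lt_one (s • ν) hs')
  simpa only [lintegral_add_measure] using this.symm

/-! ### Moments of ladder heights -/

/-- The Wiener-Hopf identity `ν = F + G - F ∗ G`, where `F` lives on `(0, ∞)` and `G` on
`(-∞, 0]`. -/
structure IsWienerHopf (ν F G : Measure ℝ) : Prop where
  add_eq : ∀ f : ℝ → ℝ≥0∞, Measurable f →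
    ∫⁻ x, f x ∂F + ∫⁻ x, f x ∂G = ∫⁻ x, f x ∂ν + ∫⁻ x, f x ∂(F ∗ G)
  pos : ∀ᵐ x ∂F, 0 < x
  nonpos : ∀ᵐ x ∂G, x ≤ 0
  univ_le : G Set.univ ≤ 1

namespace IsWienerHopf

variable {ν F G : Measure ℝ}

/-- Splitting ∫ f dF into the parts of weight 1 - G(ℝ) and G(ℝ) puts all but the deficit term over
`F.prod G`, where integrands can be compared pointwise without subtraction. -/
theorem lintegral_add_eq [IsProbabilityMeasure F] [SFinite G] (h : IsWienerHopf ν F G) {f : ℝ → ℝ≥0∞} (hf : Measurable f) :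
    ∫⁻ x, f x ∂ν + ∫⁻ p : ℝ × ℝ, f (p.1 + p.2) ∂(F.prod G) =
      (1 - G Set.univ) * ∫⁻ x, f x ∂F + ∫⁻ p : ℝ × ℝ, (f p.1 + f p.2) ∂(F.prod G) := by
  have h1 : ∫⁻ p : ℝ × ℝ, f p.1 ∂(F.prod G) = G Set.univ * ∫⁻ x, f x ∂F := by
    rw [lintegral_prod _ (by fun_prop)]
    simp only [lintegral_const]
    rw [lintegral_mul_const _ hf, mul_comm]
  have h2 : ∫⁻ p : ℝ × ℝ, f p.2 ∂(F.prod G) = ∫⁻ x, f x ∂G := by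
    rw [lintegral_prod _ (by fun_prop)]
    simp
  rw [lintegral_add_left (by fun_prop), h1, h2, ← add_assoc, ← add_mul,
    tsub_add_cancel_of_le h.univ_le, one_mul, h.add_eq f hf,
    Measure.lintegral_conv hf, lintegral_prod _ (by fun_prop)]

theorem ae_prod [SFinite F] [SFinite G] (h : IsWienerHopf ν F G) : ∀ᵐ p : ℝ × ℝ ∂(F.prod G), 0 < p.1 ∧ p.2 ≤ 0 := by
  have hm : MeasurableSet {p : ℝ × ℝ | 0 < p.1 ∧ p.2 ≤ 0} := by measurability
  refine (Measure.ae_prod_iff_ae_ae hm).2 ?_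
  filter_upwards [h.pos] with x hx
  filter_upwards [h.nonpos] with y hy using ⟨hx, hy⟩

/-- This finite term is cancelled in the moment comparisons. It is the reason for truncating at K
first, since moments of the ladder heights are not known to be finite. -/
theorem lintegral_add_ne_top [IsFiniteMeasure F] (h : IsWienerHopf ν F G) {f : ℝ → ℝ≥0∞} {c : ℝ≥0∞} (hc : c ≠ ⊤)
    (hf : ∀ x, f x ≤ c) : ∫⁻ p : ℝ × ℝ, f (p.1 + p.2) ∂(F.prod G) ≠ ⊤ := by
  have : IsFiniteMeasure G := ⟨h.univ_le.trans_lt ENNReal.one_lt_top⟩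
  refine ne_top_of_le_ne_top ?_ (lintegral_mono fun p => hf (p.1 + p.2))
  rw [lintegral_const]
  exact ENNReal.mul_ne_top hc (measure_ne_top _ _)

/-- The truncated form of a² + b² = (a + b)² + 2a(-b). -/
theorem truncated_sq_le {a b K : ℝ} (ha : 0 < a) (hb : b ≤ 0) (hK : 0 ≤ K) :
    min |a| K ^ 2 + min |b| K ^ 2 ≤ min |a + b| K ^ 2 + 2 * (a * (-b)) := by
  obtain ⟨c, rfl⟩ : ∃ c, b = -c := ⟨-b, by ring⟩
  have hc : 0 ≤ c := by linarith
  rw [abs_neg, abs_of_pos ha, abs_of_nonneg hc, neg_neg]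
  have h1 : min a K ≤ a := min_le_left _ _
  have h2 : min c K ≤ c := min_le_left _ _
  have h3 : min a K ≤ K := min_le_right _ _
  have h4 : min c K ≤ K := min_le_right _ _
  have h5 : 0 ≤ min a K := le_min ha.le hK
  have h6 : 0 ≤ min c K := le_min hc hK
  rcases le_total |a + -c| K with h | h
  · rw [min_eq_left h, sq_abs]
    nlinarith
  · rw [min_eq_right h]
    rcases le_abs'.1 h with h' | h'
    · nlinarith
    · nlinarith

/-- With c = -b, the untruncated inequality is |a - c|³ + a²c ≤ a³ + c³. The gain a²c is kept only
where neither variable is truncated; otherwise one term on the right is already K³. -/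
theorem truncated_cube_le {a b K : ℝ} (ha : 0 < a) (hb : b ≤ 0) (hK : 0 ≤ K) :
    min |a + b| K ^ 3 + (if a ≤ K ∧ -b ≤ K then a ^ 2 * (-b) else 0) ≤
      min |a| K ^ 3 + min |b| K ^ 3 := by
  obtain ⟨c, rfl⟩ : ∃ c, b = -c := ⟨-b, by ring⟩
  have hc : 0 ≤ c := by linarith
  rw [abs_neg, abs_of_pos ha, abs_of_nonneg hc, neg_neg]
  have h5 : 0 ≤ min a K := le_min ha.le hK
  have h6 : 0 ≤ min c K := le_min hc hK
  have h7 : min |a + -c| K ^ 3 ≤ K ^ 3 :=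
    pow_le_pow_left₀ (le_min (abs_nonneg _) hK) (min_le_right _ _) 3
  split_ifs with h
  · rw [min_eq_left h.1, min_eq_left h.2]
    have h8 : min |a + -c| K ^ 3 ≤ |a + -c| ^ 3 :=
      pow_le_pow_left₀ (le_min (abs_nonneg _) hK) (min_le_left _ _) 3
    refine (add_le_add_left h8 _).trans ?_
    rcases le_total c a with hca | hca
    · rw [abs_of_nonneg (by linarith)]
      nlinarith [mul_nonneg hc (sq_nonneg (a - c)), mul_nonneg hc (mul_nonneg ha.le hc)]
    · rw [abs_of_nonpos (by linarith)]
      nlinarith [mul_nonneg ha.le (sq_nonneg (a - c)), mul_nonneg ha.le (mul_nonneg hc hc)]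
  · rw [add_zero]
    rcases not_and_or.1 h with h | h
    · rw [min_eq_right (not_le.1 h).le]
      have := pow_nonneg h6 3
      linarith
    · rw [min_eq_right (not_le.1 h).le]
      have := pow_nonneg h5 3
      linarith

theorem min_abs_pow_le (x : ℝ) (K k : ℕ) :
    ENNReal.ofReal (min |x| K ^ k) ≤ ENNReal.ofReal (|x| ^ k) :=
  ENNReal.ofReal_le_ofReal
    (pow_le_pow_left₀ (le_min (abs_nonneg _) K.cast_nonneg) (min_le_left _ _) k)

theorem tendsto_lintegral_min_abs_pow (μ : Measure ℝ) (k : ℕ) :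
    Filter.Tendsto (fun K : ℕ => ∫⁻ x, ENNReal.ofReal (min |x| K ^ k) ∂μ) Filter.atTop
      (nhds (∫⁻ x, ENNReal.ofReal (|x| ^ k) ∂μ)) := by
  refine lintegral_tendsto_of_tendsto_of_monotone (fun K => by fun_prop) (ae_of_all _ fun x => ?_)
    (ae_of_all _ fun x => ?_)
  · intro m n hmn
    refine ENNReal.ofReal_le_ofReal (pow_le_pow_left₀ (le_min (abs_nonneg _) m.cast_nonneg)
      (min_le_min_left _ (Nat.cast_le.2 hmn)) k)
  · refine tendsto_const_nhds.congr' ?_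
    filter_upwards [Filter.eventually_ge_atTop ⌈|x|⌉₊] with K hK
    rw [min_eq_left (Nat.ceil_le.1 hK)]

/-- Upper bound for the second moment of the step law by the moments of the ladder heights. -/
theorem second_moment_le [IsProbabilityMeasure F] [SFinite G] (h : IsWienerHopf ν F G) :
    ∫⁻ x, ENNReal.ofReal (|x| ^ 2) ∂ν ≤ (1 - G Set.univ) * ∫⁻ x, ENNReal.ofReal (|x| ^ 2) ∂F +
      2 * ((∫⁻ x, ENNReal.ofReal x ∂F) * ∫⁻ x, ENNReal.ofReal (-x) ∂G) := by
  refine le_of_tendsto' (tendsto_lintegral_min_abs_pow ν 2) fun K => ?_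
  set f : ℝ → ℝ≥0∞ := fun x => ENNReal.ofReal (min |x| K ^ 2) with hfdef
  have hf : Measurable f := by fun_prop
  have hfin := h.lintegral_add_ne_top (f := f) (c := ENNReal.ofReal (K ^ 2))
    ENNReal.ofReal_ne_top fun x => ENNReal.ofReal_le_ofReal
      (pow_le_pow_left₀ (le_min (abs_nonneg _) K.cast_nonneg) (min_le_right _ _) 2)
  have hle : ∫⁻ p : ℝ × ℝ, (f p.1 + f p.2) ∂(F.prod G) ≤
      ∫⁻ p : ℝ × ℝ, f (p.1 + p.2) ∂(F.prod G) +
        2 * ((∫⁻ x, ENNReal.ofReal x ∂F) * ∫⁻ x, ENNReal.ofReal (-x) ∂G) := by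
    rw [← lintegral_prod_mul (by fun_prop) (by fun_prop), ← lintegral_const_mul _ (by fun_prop),
      ← lintegral_add_left (by fun_prop)]
    refine lintegral_mono_ae ?_
    filter_upwards [h.ae_prod] with p hp
    have h2 : (2 : ℝ≥0∞) = ENNReal.ofReal 2 := by simp
    rw [h2, ← ENNReal.ofReal_mul hp.1.le, ← ENNReal.ofReal_mul zero_le_two,
      ← ENNReal.ofReal_add (by positivity) (by positivity),
      ← ENNReal.ofReal_add (by positivity) (by nlinarith)]
    exact ENNReal.ofReal_le_ofReal (truncated_sq_le hp.1 hp.2 K.cast_nonneg)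
  have hb := h.lintegral_add_eq hf
  refine (ENNReal.add_le_add_iff_right hfin).1 ?_
  calc ∫⁻ x, f x ∂ν + ∫⁻ p : ℝ × ℝ, f (p.1 + p.2) ∂(F.prod G)
      = (1 - G Set.univ) * ∫⁻ x, f x ∂F + ∫⁻ p : ℝ × ℝ, (f p.1 + f p.2) ∂(F.prod G) := hb
    _ ≤ (1 - G Set.univ) * ∫⁻ x, ENNReal.ofReal (|x| ^ 2) ∂F + _ := by
        refine add_le_add ?_ hle
        gcongr with x
        exact min_abs_pow_le x K 2
    _ = _ := by ring

/-- Lower bound for the third moment of the step law by the moments of the ladder heights. -/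
theorem le_third_moment [IsProbabilityMeasure F] [SFinite G] (h : IsWienerHopf ν F G) :
    (1 - G Set.univ) * ∫⁻ x, ENNReal.ofReal (|x| ^ 3) ∂F +
      (∫⁻ x, ENNReal.ofReal (|x| ^ 2) ∂F) * ∫⁻ x, ENNReal.ofReal (-x) ∂G ≤
      ∫⁻ x, ENNReal.ofReal (|x| ^ 3) ∂ν := by
  rw [← lintegral_prod_mul (by fun_prop) (by fun_prop)]
  have hφ : Filter.Tendsto (fun K : ℕ => ∫⁻ p : ℝ × ℝ, {p : ℝ × ℝ | p.1 ≤ K ∧ -p.2 ≤ K}.indicator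
      (fun p => ENNReal.ofReal (|p.1| ^ 2) * ENNReal.ofReal (-p.2)) p ∂(F.prod G)) Filter.atTop
      (nhds (∫⁻ p : ℝ × ℝ, ENNReal.ofReal (|p.1| ^ 2) * ENNReal.ofReal (-p.2) ∂(F.prod G))) := by
    refine lintegral_tendsto_of_tendsto_of_monotone (fun K => ?_) (ae_of_all _ fun p => ?_)
      (ae_of_all _ fun p => ?_)
    · exact (Measurable.indicator (by fun_prop) (by measurability)).aemeasurable
    · intro m n hmn
      have : (m : ℝ) ≤ n := by exact_mod_cast hmn
      refine Set.indicator_le_indicator_of_subset (fun q hq => ?_) (fun _ => zero_le) p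
      rw [Set.mem_ofPred_eq] at hq ⊢
      exact ⟨hq.1.trans this, hq.2.trans this⟩
    · refine tendsto_const_nhds.congr' ?_
      filter_upwards [Filter.eventually_ge_atTop (max ⌈p.1⌉₊ ⌈-p.2⌉₊)] with K hK
      rw [Set.indicator_of_mem]
      exact ⟨Nat.ceil_le.1 (le_of_max_le_left hK), Nat.ceil_le.1 (le_of_max_le_right hK)⟩
  have hβ : 1 - G Set.univ ≠ ⊤ := ne_top_of_le_ne_top ENNReal.one_ne_top tsub_le_self
  refine le_of_tendsto' ((ENNReal.Tendsto.const_mul (tendsto_lintegral_min_abs_pow F 3)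
    (Or.inr hβ)).add hφ) fun K => ?_
  set f : ℝ → ℝ≥0∞ := fun x => ENNReal.ofReal (min |x| K ^ 3) with hfdef
  have hf : Measurable f := by fun_prop
  have hfin := h.lintegral_add_ne_top (f := f) (c := ENNReal.ofReal (K ^ 3))
    ENNReal.ofReal_ne_top fun x => ENNReal.ofReal_le_ofReal
      (pow_le_pow_left₀ (le_min (abs_nonneg _) K.cast_nonneg) (min_le_right _ _) 3)
  have hle : ∫⁻ p : ℝ × ℝ, f (p.1 + p.2) ∂(F.prod G) +
      ∫⁻ p : ℝ × ℝ, {p : ℝ × ℝ | p.1 ≤ K ∧ -p.2 ≤ K}.indicator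
        (fun p => ENNReal.ofReal (|p.1| ^ 2) * ENNReal.ofReal (-p.2)) p ∂(F.prod G) ≤
      ∫⁻ p : ℝ × ℝ, (f p.1 + f p.2) ∂(F.prod G) := by
    rw [← lintegral_add_left (by fun_prop)]
    refine lintegral_mono_ae ?_
    filter_upwards [h.ae_prod] with p hp
    have key := truncated_cube_le hp.1 hp.2 (K.cast_nonneg (α := ℝ))
    have h0 : 0 ≤ -p.2 := by linarith [hp.2]
    rw [← ENNReal.ofReal_add (by positivity) (by positivity)]
    refine le_trans ?_ (ENNReal.ofReal_le_ofReal key)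
    rw [ENNReal.ofReal_add (by positivity) (by split_ifs <;> positivity)]
    gcongr
    rw [Set.indicator_apply]
    simp only [Set.mem_ofPred_eq]
    split_ifs
    · rw [sq_abs, ENNReal.ofReal_mul (by positivity)]
    · exact zero_le
  refine (ENNReal.add_le_add_iff_right hfin).1 ?_
  calc _ = (1 - G Set.univ) * ∫⁻ x, f x ∂F + (∫⁻ p : ℝ × ℝ, f (p.1 + p.2) ∂(F.prod G) +
      ∫⁻ p : ℝ × ℝ, {p : ℝ × ℝ | p.1 ≤ K ∧ -p.2 ≤ K}.indicator
        (fun p => ENNReal.ofReal (|p.1| ^ 2) * ENNReal.ofReal (-p.2)) p ∂(F.prod G)) := by ring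
    _ ≤ (1 - G Set.univ) * ∫⁻ x, f x ∂F + ∫⁻ p : ℝ × ℝ, (f p.1 + f p.2) ∂(F.prod G) := by gcongr
    _ = ∫⁻ x, f x ∂ν + ∫⁻ p : ℝ × ℝ, f (p.1 + p.2) ∂(F.prod G) := (h.lintegral_add_eq hf).symm
    _ ≤ _ := by
        gcongr with x
        exact min_abs_pow_le x K 3

/-- Cauchy-Schwarz, obtained by integrating ab(a - b)² ≥ 0 against `F.prod F`, so that infinite
moments need no separate treatment. -/
theorem sq_moment_mul_self_le [SFinite F] (hF : ∀ᵐ x ∂F, 0 < x) :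
    (∫⁻ x, ENNReal.ofReal (|x| ^ 2) ∂F) * ∫⁻ x, ENNReal.ofReal (|x| ^ 2) ∂F ≤
      (∫⁻ x, ENNReal.ofReal x ∂F) * ∫⁻ x, ENNReal.ofReal (|x| ^ 3) ∂F := by
  have hae : ∀ᵐ p : ℝ × ℝ ∂(F.prod F), 0 < p.1 ∧ 0 < p.2 := by
    have hm : MeasurableSet {p : ℝ × ℝ | 0 < p.1 ∧ 0 < p.2} := by measurability
    refine (Measure.ae_prod_iff_ae_ae hm).2 ?_
    filter_upwards [hF] with x hx
    filter_upwards [hF] with y hy using ⟨hx, hy⟩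
  refine (ENNReal.mul_le_mul_iff_right two_ne_zero ENNReal.ofNat_ne_top).1 ?_
  conv_rhs => rw [two_mul, mul_comm (∫⁻ x, ENNReal.ofReal x ∂F)]
  conv_rhs => arg 2; rw [mul_comm]
  rw [← lintegral_prod_mul (by fun_prop) (by fun_prop),
    ← lintegral_prod_mul (by fun_prop) (by fun_prop),
    ← lintegral_prod_mul (by fun_prop) (by fun_prop), ← lintegral_const_mul _ (by fun_prop),
    ← lintegral_add_left (by fun_prop)]
  refine lintegral_mono_ae ?_
  filter_upwards [hae] with p ⟨h1, h2⟩
  have e2 : (2 : ℝ≥0∞) = ENNReal.ofReal 2 := by simp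
  rw [abs_of_pos h1, abs_of_pos h2, ← ENNReal.ofReal_mul (by positivity),
    ← ENNReal.ofReal_mul (by positivity), ← ENNReal.ofReal_mul (by positivity), e2,
    ← ENNReal.ofReal_mul (by positivity), ← ENNReal.ofReal_add (by positivity) (by positivity)]
  refine ENNReal.ofReal_le_ofReal ?_
  nlinarith [mul_nonneg (mul_pos h1 h2).le (sq_nonneg (p.1 - p.2))]

/-- With β = 1 - G(ℝ), the ingredients are E X² ≤ βh₂ + 2h₁g₁, βh₃ + h₂g₁ ≤ E|X|³ and h₂² ≤ h₁h₃.
Multiplying the first by h₂ makes the second appear with the factor 2h₁. -/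
theorem sq_moment_mul_le [IsProbabilityMeasure F] [SFinite G] (h : IsWienerHopf ν F G) :
    (∫⁻ x, ENNReal.ofReal (|x| ^ 2) ∂F) * ∫⁻ x, ENNReal.ofReal (|x| ^ 2) ∂ν ≤
      2 * (∫⁻ x, ENNReal.ofReal (|x| ^ 3) ∂ν) * ∫⁻ x, ENNReal.ofReal x ∂F := by
  set h1 := ∫⁻ x, ENNReal.ofReal x ∂F
  set h2 := ∫⁻ x, ENNReal.ofReal (|x| ^ 2) ∂F
  set h3 := ∫⁻ x, ENNReal.ofReal (|x| ^ 3) ∂F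
  set g1 := ∫⁻ x, ENNReal.ofReal (-x) ∂G
  calc h2 * ∫⁻ x, ENNReal.ofReal (|x| ^ 2) ∂ν
      ≤ h2 * ((1 - G Set.univ) * h2 + 2 * (h1 * g1)) := by gcongr; exact h.second_moment_le
    _ = (1 - G Set.univ) * (h2 * h2) + 2 * (h2 * g1) * h1 := by ring
    _ ≤ 2 * ((1 - G Set.univ) * (h1 * h3)) + 2 * (h2 * g1) * h1 := by
        refine add_le_add_left ?_ _
        rw [two_mul]
        exact le_add_of_le_of_nonneg
          (mul_le_mul_right (sq_moment_mul_self_le h.pos) _) zero_le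
    _ = 2 * ((1 - G Set.univ) * h3 + h2 * g1) * h1 := by ring
    _ ≤ _ := by gcongr; exact h.le_third_moment

end IsWienerHopf

/-! ### The first ascending ladder height under positive drift -/

theorem lintegral_killedLaw_succ_add (ν : Measure ℝ) [IsFiniteMeasure ν] {S : Set ℝ}
    (hS : MeasurableSet S) (n : ℕ) {f : ℝ → ℝ≥0∞} (hf : Measurable f) :
    ∫⁻ x, f x ∂(killedLaw ν S (n + 1)) + ∫⁻ x, f x ∂(exitLawAt ν S n) =
      ∫⁻ x, ∫⁻ y, f (x + y) ∂ν ∂(killedLaw ν S n) := by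
  rw [← lintegral_add_measure, killedLaw_succ_add_exitLawAt ν hS, Measure.lintegral_conv hf]

theorem sum_exitLawAt_univ_add (ν : Measure ℝ) [IsProbabilityMeasure ν] {S : Set ℝ}
    (hS : MeasurableSet S) (n : ℕ) :
    ∑ k ∈ Finset.range n, exitLawAt ν S k Set.univ + killedLaw ν S n Set.univ = 1 := by
  induction n with
  | zero => simp [killedLaw_zero]
  | succ n ih =>
    have h := congrArg (fun μ : Measure ℝ => μ Set.univ) (killedLaw_succ_add_exitLawAt ν hS n)
    simp only [Measure.add_apply, conv_univ, measure_univ, mul_one] at h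
    rw [Finset.sum_range_succ, add_assoc, add_comm (exitLawAt ν S n _), h, ih]

theorem exitLaw_univ_le_one (ν : Measure ℝ) [IsProbabilityMeasure ν] {S : Set ℝ}
    (hS : MeasurableSet S) : exitLaw ν S Set.univ ≤ 1 := by
  rw [exitLaw, Measure.sum_apply _ MeasurableSet.univ, ENNReal.tsum_eq_iSup_nat]
  exact iSup_le fun n => le_self_add.trans (sum_exitLawAt_univ_add ν hS n).le

/-- The total masses in the balance equation satisfy g + e = 1 + g, and a finite g cancels. -/
theorem exitLaw_univ_eq_one (ν : Measure ℝ) [IsProbabilityMeasure ν] {S : Set ℝ}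
    (hS : MeasurableSet S) (h : greenLaw ν S Set.univ ≠ ⊤) : exitLaw ν S Set.univ = 1 := by
  have := congrArg (fun μ : Measure ℝ => μ Set.univ) (greenLaw_add_exitLaw ν hS)
  simp only [Measure.add_apply, conv_univ, measure_univ, mul_one] at this
  rw [add_comm 1] at this
  exact (ENNReal.add_right_inj h).1 this

theorem exists_integral_min_pos (ν : Measure ℝ) (hint : Integrable (fun y => y) ν)
    (hpos : 0 < ∫ y, y ∂ν) : ∃ C : ℝ, 0 ≤ C ∧ 0 < ∫ y, min y C ∂ν := by
  have ht : Filter.Tendsto (fun n : ℕ => ∫ y, min y (n : ℝ) ∂ν) Filter.atTop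
      (nhds (∫ y, y ∂ν)) := by
    refine tendsto_integral_of_dominated_convergence (fun y => |y|) (fun n => by fun_prop)
      hint.abs (fun n => ae_of_all _ fun y => ?_) (ae_of_all _ fun y => ?_)
    · rw [Real.norm_eq_abs]
      rcases le_total y n with h | h
      · rw [min_eq_left h]
      · rw [min_eq_right h, Nat.abs_cast]
        exact h.trans (le_abs_self y)
    · refine tendsto_const_nhds.congr' ?_
      filter_upwards [Filter.eventually_ge_atTop ⌈y⌉₊] with n hn
      rw [min_eq_left (Nat.ceil_le.1 hn)]
  obtain ⟨n, hn⟩ := ((tendsto_order.1 ht).1 0 hpos).exists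
  exact ⟨n, n.cast_nonneg, hn⟩

/-- Drift condition for the potential (C - x)⁺: pointwise (C - x - y)⁺ + min(y, C) ≤ C - x, where x
≤ 0 covers the case in which the positive part vanishes. -/
theorem lintegral_sub_add_le (ν : Measure ℝ) [IsProbabilityMeasure ν]
    (hint : Integrable (fun y => y) ν) {C x : ℝ} (hpos : 0 < ∫ y, min y C ∂ν)
    (hx : x ≤ 0) :
    ∫⁻ y, ENNReal.ofReal (C - (x + y)) ∂ν + ENNReal.ofReal (∫ y, min y C ∂ν) ≤
      ENNReal.ofReal (C - x) := by
  have hi1 : Integrable (fun y => min y C) ν := hint.inf (integrable_const C)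
  have hi2 : Integrable (fun y => max (C - (x + y)) 0) ν :=
    ((integrable_const C).sub ((integrable_const x).add hint)).sup (integrable_const 0)
  have h1 : ∫⁻ y, ENNReal.ofReal (C - (x + y)) ∂ν =
      ENNReal.ofReal (∫ y, max (C - (x + y)) 0 ∂ν) := by
    rw [ofReal_integral_eq_lintegral_ofReal hi2 (ae_of_all _ fun y => le_max_right _ _)]
    refine lintegral_congr fun y => ?_
    rw [ENNReal.ofReal_max, ENNReal.ofReal_zero, max_eq_left zero_le]
  rw [h1, ← ENNReal.ofReal_add 
      (show 0 ≤ ∫ y, max (C - (x + y)) 0 ∂ν from integral_nonneg fun y => le_max_right _ _) hpos.le,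
    ← integral_add hi2 hi1]
  refine ENNReal.ofReal_le_ofReal ?_
  calc ∫ y, (max (C - (x + y)) 0 + min y C) ∂ν ≤ ∫ _, (C - x) ∂ν := by
        refine integral_mono (hi2.add hi1) (integrable_const _) fun y => ?_
        show max (C - (x + y)) 0 + min y C ≤ C - x
        rcases le_total (C - (x + y)) 0 with h | h
        · rw [max_eq_right h, zero_add]
          exact (min_le_right _ _).trans (by linarith)
        · rw [max_eq_left h]
          linarith [min_le_left y C]
    _ = C - x := by simp

/-- Foster-Lyapunov argument: the potential C - x starts at C and loses at least δ in mean for each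
unit of time in (-∞, 0], so the expected time there is at most C / δ. -/
theorem greenLaw_Iic_univ_ne_top (ν : Measure ℝ) [IsProbabilityMeasure ν]
    (hint : Integrable (fun y => y) ν) (hpos : 0 < ∫ y, y ∂ν) :
    greenLaw ν (Set.Iic 0) Set.univ ≠ ⊤ := by
  obtain ⟨C, hC, hδ⟩ := exists_integral_min_pos ν hint hpos
  set δ := ENNReal.ofReal (∫ y, min y C ∂ν)
  have hδ' : δ ≠ 0 := (ENNReal.ofReal_pos.2 hδ).ne'
  set φ : ℝ → ℝ≥0∞ := fun x => ENNReal.ofReal (C - x)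
  have hφ : Measurable φ := by fun_prop
  have step (n : ℕ) : ∑ k ∈ Finset.range n, δ * killedLaw ν (Set.Iic 0) k Set.univ +
      ∫⁻ x, φ x ∂(killedLaw ν (Set.Iic 0) n) ≤ ENNReal.ofReal C := by
    induction n with
    | zero => simp [killedLaw_zero, φ]
    | succ n ih =>
      refine le_trans ?_ ih
      rw [Finset.sum_range_succ, add_assoc]
      gcongr
      calc δ * killedLaw ν (Set.Iic 0) n Set.univ + ∫⁻ x, φ x ∂(killedLaw ν (Set.Iic 0) (n + 1))
          ≤ ∫⁻ x, δ ∂(killedLaw ν (Set.Iic 0) n) +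
              ∫⁻ x, ∫⁻ y, φ (x + y) ∂ν ∂(killedLaw ν (Set.Iic 0) n) := by
            rw [lintegral_const, ← lintegral_killedLaw_succ_add ν measurableSet_Iic n hφ]
            gcongr
            exact le_self_add
        _ ≤ ∫⁻ x, φ x ∂(killedLaw ν (Set.Iic 0) n) := by
            rw [← lintegral_add_left measurable_const]
            refine lintegral_mono_ae ?_
            filter_upwards [killedLaw_ae_mem ν measurableSet_Iic (Set.mem_Iic.2 le_rfl) n]
              with x hx
            rw [add_comm]
            exact lintegral_sub_add_le ν hint hδ hx
  have hb : δ * greenLaw ν (Set.Iic 0) Set.univ ≤ ENNReal.ofReal C := by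
    rw [greenLaw, Measure.sum_apply _ MeasurableSet.univ, ← ENNReal.tsum_mul_left,
      ENNReal.tsum_eq_iSup_nat]
    exact iSup_le fun n => le_self_add.trans (step n)
  intro h
  rw [h, ENNReal.mul_top hδ'] at hb
  exact ENNReal.ofReal_ne_top (top_le_iff.1 hb)

theorem lintegral_pos_add_eq (ν : Measure ℝ) [IsProbabilityMeasure ν]
    (hint : Integrable (fun y => y) ν) (hpos : 0 < ∫ y, y ∂ν) {x : ℝ} (hx : x ≤ 0) :
    ∫⁻ y, ENNReal.ofReal (x + y) ∂ν + ENNReal.ofReal (-x) =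
      ∫⁻ y, ENNReal.ofReal (-(x + y)) ∂ν + ENNReal.ofReal (∫ y, y ∂ν) := by
  have hi : Integrable (fun y => x + y) ν := (integrable_const x).add hint
  have h1 : ∫⁻ y, ENNReal.ofReal (x + y) ∂ν ≠ ⊤ := hi.lintegral_lt_top.ne
  have h2 : ∫⁻ y, ENNReal.ofReal (-(x + y)) ∂ν ≠ ⊤ := hi.neg.lintegral_lt_top.ne
  have h := integral_eq_lintegral_pos_part_sub_lintegral_neg_part hi
  rw [integral_add (integrable_const x) hint, integral_const, probReal_univ, one_smul] at h
  rw [← ENNReal.toReal_eq_toReal_iff' (by finiteness) (by finiteness),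
    ENNReal.toReal_add h1 ENNReal.ofReal_ne_top, ENNReal.toReal_add h2 ENNReal.ofReal_ne_top,
    ENNReal.toReal_ofReal (by linarith), ENNReal.toReal_ofReal hpos.le]
  linarith

/-- One half of Wald's identity for the first ascending ladder epoch. The mean of -S_n on survival
is nonnegative and is simply dropped, so it need not be shown to vanish. -/
theorem drift_mul_greenLaw_le (ν : Measure ℝ) [IsProbabilityMeasure ν]
    (hint : Integrable (fun y => y) ν) (hpos : 0 < ∫ y, y ∂ν) :
    ENNReal.ofReal (∫ y, y ∂ν) * greenLaw ν (Set.Iic 0) Set.univ ≤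
      ∫⁻ x, ENNReal.ofReal x ∂(exitLaw ν (Set.Iic 0)) := by
  set μ := ENNReal.ofReal (∫ y, y ∂ν)
  have hS : MeasurableSet (Set.Iic (0 : ℝ)) := measurableSet_Iic
  have hk (n : ℕ) : ∫⁻ x, ENNReal.ofReal x ∂(killedLaw ν (Set.Iic 0) n) = 0 := by
    rw [lintegral_eq_zero_iff (by fun_prop)]
    filter_upwards [killedLaw_ae_mem ν hS (Set.mem_Iic.2 le_rfl) n] with x hx
    exact ENNReal.ofReal_of_nonpos hx
  have he (n : ℕ) : ∫⁻ x, ENNReal.ofReal (-x) ∂(exitLawAt ν (Set.Iic 0) n) = 0 := by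
    rw [lintegral_eq_zero_iff (by fun_prop)]
    filter_upwards [ae_restrict_mem hS.compl] with x hx
    have hx' : 0 < x := by simpa using hx
    exact ENNReal.ofReal_of_nonpos (by linarith)
  have step (n : ℕ) : ∑ k ∈ Finset.range n, ∫⁻ x, ENNReal.ofReal x ∂(exitLawAt ν (Set.Iic 0) k) =
      ∫⁻ x, ENNReal.ofReal (-x) ∂(killedLaw ν (Set.Iic 0) n) +
        ∑ k ∈ Finset.range n, μ * killedLaw ν (Set.Iic 0) k Set.univ := by
    induction n with
    | zero => simp [killedLaw_zero]
    | succ n ih =>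
      have h1 := lintegral_killedLaw_succ_add ν hS n (f := fun x => ENNReal.ofReal x) (by fun_prop)
      have h2 := lintegral_killedLaw_succ_add ν hS n (f := fun x => ENNReal.ofReal (-x))
        (by fun_prop)
      rw [hk, zero_add] at h1
      rw [he, add_zero] at h2
      have h3 : ∫⁻ x, ENNReal.ofReal x ∂(exitLawAt ν (Set.Iic 0) n) +
          ∫⁻ x, ENNReal.ofReal (-x) ∂(killedLaw ν (Set.Iic 0) n) =
          ∫⁻ x, ENNReal.ofReal (-x) ∂(killedLaw ν (Set.Iic 0) (n + 1)) +
            μ * killedLaw ν (Set.Iic 0) n Set.univ := by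
        rw [h1, h2, ← lintegral_const, ← lintegral_add_right _ (by fun_prop),
          ← lintegral_add_right _ (by fun_prop)]
        refine lintegral_congr_ae ?_
        filter_upwards [killedLaw_ae_mem ν hS (Set.mem_Iic.2 le_rfl) n] with x hx
        exact lintegral_pos_add_eq ν hint hpos hx
      rw [Finset.sum_range_succ, Finset.sum_range_succ, ih, add_right_comm, add_comm _ (∫⁻ _, _ ∂_),
        h3]
      ring
  rw [greenLaw, Measure.sum_apply _ MeasurableSet.univ, ← ENNReal.tsum_mul_left, exitLaw,
    lintegral_sum_measure, ENNReal.tsum_eq_iSup_nat, ENNReal.tsum_eq_iSup_nat]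
  exact iSup_mono fun n => by rw [step n]; exact le_add_self

/-- A ladder height is a position ≤ 0 plus a step, hence at most that step; summing over all visits
before the exit produces the Green mass. -/
theorem lintegral_exitLaw_Iic_le (ν : Measure ℝ) [IsProbabilityMeasure ν] {f : ℝ → ℝ≥0∞}
    (hf : Measurable f) (hmono : Monotone f) :
    ∫⁻ x, f x ∂(exitLaw ν (Set.Iic 0)) ≤ greenLaw ν (Set.Iic 0) Set.univ * ∫⁻ y, f y ∂ν := by
  refine (lintegral_mono' (exitLaw_le ν (Set.Iic 0)) le_rfl).trans ?_
  rw [Measure.lintegral_conv hf, mul_comm, ← lintegral_const]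
  refine lintegral_mono_ae ?_
  filter_upwards [greenLaw_ae_mem ν (S := Set.Iic 0) (T := Set.Iic 0) measurableSet_Iic
    measurableSet_Iic subset_rfl (Set.mem_Iic.2 le_rfl)] with x hx
  exact lintegral_mono fun y => hmono (by linarith [Set.mem_Iic.1 hx])

theorem isWienerHopf_exitLaw (ν : Measure ℝ) [IsProbabilityMeasure ν] :
    IsWienerHopf ν (exitLaw ν (Set.Iic 0)) (exitLaw ν (Set.Ioi 0)) where
  add_eq _ hf := lintegral_exitLaw_add_exitLaw ν hf
  pos := (exitLaw_ae_notMem ν measurableSet_Iic).mono fun _ hx => not_le.1 hx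
  nonpos := (exitLaw_ae_notMem ν measurableSet_Ioi).mono fun _ hx => not_lt.1 hx
  univ_le := exitLaw_univ_le_one ν measurableSet_Ioi

theorem isProbabilityMeasure_exitLaw_Iic (ν : Measure ℝ) [IsProbabilityMeasure ν]
    (hint : Integrable (fun y => y) ν) (hpos : 0 < ∫ y, y ∂ν) :
    IsProbabilityMeasure (exitLaw ν (Set.Iic 0)) :=
  ⟨exitLaw_univ_eq_one ν measurableSet_Iic (greenLaw_Iic_univ_ne_top ν hint hpos)⟩

/-- The mean overshoot bound of Lorden, as a bound for the ladder height. -/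
theorem ladder_sq_moment_mul_le (ν : Measure ℝ) [IsProbabilityMeasure ν]
    (hint : Integrable (fun y => y) ν) (hpos : 0 < ∫ y, y ∂ν) :
    (∫⁻ x, ENNReal.ofReal (|x| ^ 2) ∂(exitLaw ν (Set.Iic 0))) * ENNReal.ofReal (∫ y, y ∂ν) ≤
      (∫⁻ y, ENNReal.ofReal ((max 0 y) ^ 2) ∂ν) *
        ∫⁻ x, ENNReal.ofReal x ∂(exitLaw ν (Set.Iic 0)) := by
  have h1 : ∫⁻ x, ENNReal.ofReal (|x| ^ 2) ∂(exitLaw ν (Set.Iic 0)) =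
      ∫⁻ x, ENNReal.ofReal ((max 0 x) ^ 2) ∂(exitLaw ν (Set.Iic 0)) := by
    refine lintegral_congr_ae ?_
    filter_upwards [(isWienerHopf_exitLaw ν).pos] with x hx
    rw [abs_of_pos hx, max_eq_right hx.le]
  have h2 := lintegral_exitLaw_Iic_le ν (f := fun x => ENNReal.ofReal ((max 0 x) ^ 2))
    (by fun_prop) fun x y hxy => ENNReal.ofReal_le_ofReal
      (pow_le_pow_left₀ (le_max_left _ _) (max_le_max le_rfl hxy) 2)
  rw [h1]
  calc _ ≤ greenLaw ν (Set.Iic 0) Set.univ * (∫⁻ y, ENNReal.ofReal ((max 0 y) ^ 2) ∂ν) *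
        ENNReal.ofReal (∫ y, y ∂ν) := by gcongr
    _ = (∫⁻ y, ENNReal.ofReal ((max 0 y) ^ 2) ∂ν) *
        (ENNReal.ofReal (∫ y, y ∂ν) * greenLaw ν (Set.Iic 0) Set.univ) := by ring
    _ ≤ _ := by gcongr; exact drift_mul_greenLaw_le ν hint hpos

/-! ### Lorden's inequality for renewal processes -/

/-- For a renewal process with step law `F`, the expectation of `φ` of the overshoot over `b`,
on the event that `b` is exceeded within `n` steps. -/
def renewalOvershoot (F : Measure ℝ) (φ : ℝ → ℝ≥0∞) : ℕ → ℝ → ℝ≥0∞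
  -- A level not yet exceeded contributes 0, so the value increases with n.
  | 0, _ => 0
  | n + 1, b => ∫⁻ h, (if h ≤ b then renewalOvershoot F φ n (b - h) else φ (h - b)) ∂F

theorem measurable_renewalOvershoot_step {φ ψ : ℝ → ℝ≥0∞} (hφ : Measurable φ)
    (hψ : Measurable ψ) :
    Measurable fun p : ℝ × ℝ => if p.2 ≤ p.1 then ψ (p.1 - p.2) else φ (p.2 - p.1) :=
  Measurable.ite (measurableSet_le measurable_snd measurable_fst) (by fun_prop) (by fun_prop)

theorem measurable_renewalOvershoot (F : Measure ℝ) [SFinite F] {φ : ℝ → ℝ≥0∞}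
    (hφ : Measurable φ) (n : ℕ) : Measurable (renewalOvershoot F φ n) := by
  induction n with
  | zero => exact measurable_const
  | succ n ih => exact (measurable_renewalOvershoot_step hφ ih).lintegral_prod_right'

theorem renewalOvershoot_le_succ (F : Measure ℝ) (φ : ℝ → ℝ≥0∞) (n : ℕ) (b : ℝ) :
    renewalOvershoot F φ n b ≤ renewalOvershoot F φ (n + 1) b := by
  induction n generalizing b with
  | zero => exact zero_le
  | succ n ih =>
    refine lintegral_mono fun h => ?_
    dsimp only
    split_ifs
    · exact ih _
    · exact le_rfl

section Mean

variable (F : Measure ℝ) [IsProbabilityMeasure F]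

/-- Pathwise, the first jump over b either lands within d above b, or also passes b + d and the two
overshoots differ by exactly d. -/
theorem renewalOvershoot_le_add (n : ℕ) {b d : ℝ} (hd : 0 ≤ d) :
    renewalOvershoot F ENNReal.ofReal n b ≤
      ENNReal.ofReal d + renewalOvershoot F ENNReal.ofReal n (b + d) := by
  induction n generalizing b with
  | zero => exact zero_le
  | succ n ih =>
    rw [renewalOvershoot, renewalOvershoot]
    have : ENNReal.ofReal d = ∫⁻ _, ENNReal.ofReal d ∂F := by simp
    rw [this, ← lintegral_add_left measurable_const]
    refine lintegral_mono fun h => ?_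
    dsimp only
    split_ifs with h1 h2 h3
    · rw [show b + d - h = b - h + d by ring]; exact ih
    · linarith
    · exact le_add_right (ENNReal.ofReal_le_ofReal (by linarith))
    · rw [← ENNReal.ofReal_add hd (by linarith)]
      exact ENNReal.ofReal_le_ofReal (by linarith)

/-- If s is passed with overshoot d ≤ t, the remaining level is t - d, and `renewalOvershoot_le_add`
compares it with t at the cost d, which is the overshoot over s. -/
theorem renewalOvershoot_add_le (n : ℕ) {s t : ℝ} (ht : 0 ≤ t) :
    renewalOvershoot F ENNReal.ofReal n (s + t) ≤
      renewalOvershoot F ENNReal.ofReal n s + renewalOvershoot F ENNReal.ofReal n t := by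
  induction n generalizing s with
  | zero => exact zero_le
  | succ n ih =>
    have : renewalOvershoot F ENNReal.ofReal n t ≤ renewalOvershoot F ENNReal.ofReal (n + 1) t :=
      renewalOvershoot_le_succ F _ n t
    refine le_trans ?_ (add_le_add_right this _)
    have : renewalOvershoot F ENNReal.ofReal n t =
      ∫⁻ _, renewalOvershoot F ENNReal.ofReal n t ∂F := by simp
    rw [renewalOvershoot, renewalOvershoot, this, ← lintegral_add_right _ measurable_const]
    refine lintegral_mono fun h => ?_
    dsimp only
    split_ifs with h1 h2 h3
    · rw [show s + t - h = s - h + t by ring]; exact ih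
    · refine (renewalOvershoot_le_add F n (b := s + t - h) (d := h - s) (by linarith)).trans ?_
      rw [show s + t - h + (h - s) = t by ring]
    · linarith
    · exact le_add_right (ENNReal.ofReal_le_ofReal (by linarith))

theorem renewalOvershoot_ne_top (hF : ∫⁻ h, ENNReal.ofReal h ∂F ≠ ⊤) (n : ℕ) {b : ℝ}
    (hb : 0 ≤ b) : renewalOvershoot F ENNReal.ofReal n b ≠ ⊤ := by
  suffices h : ∀ n b, 0 ≤ b →
      renewalOvershoot F ENNReal.ofReal n b ≤ n * ∫⁻ h, ENNReal.ofReal h ∂F from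
    ne_top_of_le_ne_top (ENNReal.mul_ne_top (ENNReal.natCast_ne_top n) hF) (h n b hb)
  intro n
  induction n with
  | zero => exact fun _ _ => zero_le
  | succ n ih =>
    intro b hb
    have : (n : ℝ≥0∞) * ∫⁻ h, ENNReal.ofReal h ∂F =
      ∫⁻ _, n * ∫⁻ h, ENNReal.ofReal h ∂F ∂F := by simp
    rw [renewalOvershoot, Nat.cast_succ, add_mul, one_mul, this,
      ← lintegral_add_left measurable_const]
    refine lintegral_mono fun h => ?_
    dsimp only
    split_ifs with h1
    · exact le_add_right (ih _ (by linarith))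
    · exact le_add_left (ENNReal.ofReal_le_ofReal (by linarith))

theorem lintegral_sq_le_sq (f : ℝ → ℝ≥0∞) (hf : Measurable f) :
    (∫⁻ x, f x ∂F) ^ 2 ≤ ∫⁻ x, f x ^ 2 ∂F := by
  have key (a b : ℝ≥0∞) : 2 * (a * b) ≤ a ^ 2 + b ^ 2 := by
    wlog h : a ≤ b generalizing a b
    · rw [mul_comm a, add_comm]; exact this b a (le_of_not_ge h)
    obtain ⟨c, rfl⟩ := exists_add_of_le h
    calc 2 * (a * (a + c)) ≤ 2 * (a * (a + c)) + c ^ 2 := le_self_add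
      _ = a ^ 2 + (a + c) ^ 2 := by ring
  refine (ENNReal.mul_le_mul_iff_right two_ne_zero ENNReal.ofNat_ne_top).1 ?_
  have h1 : ∫⁻ p : ℝ × ℝ, (f p.1 ^ 2 + f p.2 ^ 2) ∂(F.prod F) = 2 * ∫⁻ x, f x ^ 2 ∂F := by
    rw [lintegral_add_left (by fun_prop), lintegral_prod _ (by fun_prop),
      lintegral_prod _ (by fun_prop), two_mul]
    simp
  rw [← h1, sq, ← lintegral_prod_mul (by fun_prop) (by fun_prop),
    ← lintegral_const_mul _ (by fun_prop)]
  exact lintegral_mono fun p => key _ _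

theorem renewalOvershoot_sq_le (n : ℕ) (b : ℝ) :
    renewalOvershoot F ENNReal.ofReal n b ^ 2 ≤
      renewalOvershoot F (fun x => ENNReal.ofReal x ^ 2) n b := by
  induction n generalizing b with
  | zero => simp [renewalOvershoot]
  | succ n ih =>
    rw [renewalOvershoot, renewalOvershoot]
    refine (lintegral_sq_le_sq F _ ?_).trans (lintegral_mono fun h => ?_)
    · exact (measurable_renewalOvershoot_step ENNReal.measurable_ofReal
        (measurable_renewalOvershoot F ENNReal.measurable_ofReal n)).comp measurable_prodMk_left
    · dsimp only
      split_ifs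
      · exact ih _
      · exact le_rfl

theorem lintegral_Icc_sub_left (f : ℝ → ℝ≥0∞) (b : ℝ) :
    ∫⁻ t in Set.Icc 0 b, f (b - t) = ∫⁻ t in Set.Icc 0 b, f t := by
  rw [← lintegral_indicator measurableSet_Icc, ← lintegral_indicator measurableSet_Icc,
    ← lintegral_sub_left_eq_self ((Set.Icc 0 b).indicator f) b]
  refine lintegral_congr fun t => ?_
  have : b - t ∈ Set.Icc 0 b ↔ t ∈ Set.Icc 0 b := by
    rw [Set.mem_Icc, Set.mem_Icc]; constructor <;> intro h <;> constructor <;> linarith [h.1, h.2]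
  by_cases ht : t ∈ Set.Icc 0 b
  · rw [Set.indicator_of_mem ht, Set.indicator_of_mem (this.2 ht)]
  · rw [Set.indicator_of_notMem ht, Set.indicator_of_notMem (mt this.1 ht)]

theorem lintegral_Icc_sub_right (f : ℝ → ℝ≥0∞) (h b : ℝ) :
    ∫⁻ t in Set.Icc h b, f (t - h) = ∫⁻ t in Set.Icc 0 (b - h), f t := by
  rw [← lintegral_indicator measurableSet_Icc, ← lintegral_indicator measurableSet_Icc,
    ← lintegral_sub_right_eq_self ((Set.Icc 0 (b - h)).indicator f) h]
  refine lintegral_congr fun t => ?_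
  have : t - h ∈ Set.Icc 0 (b - h) ↔ t ∈ Set.Icc h b := by
    rw [Set.mem_Icc, Set.mem_Icc]; constructor <;> intro h <;> constructor <;> linarith [h.1, h.2]
  by_cases ht : t ∈ Set.Icc h b
  · rw [Set.indicator_of_mem ht, Set.indicator_of_mem (this.2 ht)]
  · rw [Set.indicator_of_notMem ht, Set.indicator_of_notMem (mt this.1 ht)]

theorem two_mul_lintegral_Icc_sub {h c : ℝ} (hc : 0 ≤ c) (hch : c ≤ h) :
    2 * ∫⁻ t in Set.Icc 0 c, ENNReal.ofReal (h - t) = ENNReal.ofReal (h ^ 2 - (h - c) ^ 2) := by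
  have h1 : ∫ t in Set.Icc 0 c, (h - t) = h * c - c ^ 2 / 2 := by
    rw [integral_Icc_eq_integral_Ioc, ← intervalIntegral.integral_of_le hc,
      intervalIntegral.integral_sub (by simp) (by simp)]
    simp
    ring
  have h2 : IntegrableOn (fun t => h - t) (Set.Icc 0 c) :=
    (Continuous.continuousOn (by fun_prop)).integrableOn_compact isCompact_Icc
  rw [← ofReal_integral_eq_lintegral_ofReal h2 ?_, h1, ← ENNReal.ofReal_ofNat 2,
    ← ENNReal.ofReal_mul (by norm_num)]
  · congr 1; ring
  · filter_upwards [ae_restrict_mem measurableSet_Icc] with t ht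
    simp only [Pi.zero_apply]
    linarith [ht.2]

/-- Effect of the first step h on twice the area under the overshoot: levels t < h see h - t,
contributing h² in full when h ≤ b, and higher levels see the process restarted at h. -/
theorem two_mul_lintegral_step_le (ψ : ℝ → ℝ≥0∞) {h b : ℝ} (hh : 0 < h) (hb : 0 ≤ b) :
    2 * ∫⁻ t in Set.Icc 0 b, (if h ≤ t then ψ (t - h) else ENNReal.ofReal (h - t)) ≤
      if h ≤ b then ENNReal.ofReal (h ^ 2) + 2 * ∫⁻ t in Set.Icc 0 (b - h), ψ t
      else ENNReal.ofReal (h ^ 2 - (h - b) ^ 2) := by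
  split_ifs with hhb
  · have : Set.Icc 0 b = Set.Ico 0 h ∪ Set.Icc h b := (Set.Ico_union_Icc_eq_Icc hh.le hhb).symm
    rw [this]
    refine (mul_le_mul_right (lintegral_union_le _ _ _) _).trans ?_
    rw [mul_add]
    refine add_le_add ?_ ?_
    · have e := two_mul_lintegral_Icc_sub hh.le le_rfl
      rw [sub_self, zero_pow two_ne_zero, sub_zero] at e
      rw [← e]
      refine mul_le_mul_right ?_ _
      rw [setLIntegral_congr Ico_ae_eq_Icc.symm]
      refine setLIntegral_mono' measurableSet_Ico fun t ht => ?_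
      rw [if_neg (not_le.2 ht.2)]
    · rw [← lintegral_Icc_sub_right ψ h b]
      refine mul_le_mul_right (setLIntegral_mono' measurableSet_Icc fun t ht => ?_) _
      rw [if_pos ht.1]
  · rw [← two_mul_lintegral_Icc_sub hb (not_le.1 hhb).le]
    refine mul_le_mul_right (setLIntegral_mono' measurableSet_Icc fun t ht => ?_) _
    rw [if_neg (not_le.2 (ht.2.trans_lt (not_le.1 hhb)))]

/-- Pathwise, 2∫₀ᵇ R_t dt + R_b² is the sum of H_i² up to the passage of b, while the sum of H_i is
b + R_b. Wald's identity evaluates both means by the expected number of steps, which is then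
eliminated. The induction peels off the first step and keeps only the direction needed. -/
theorem lorden_identity_le (hF : ∀ᵐ x ∂F, 0 < x) (n : ℕ) {b : ℝ} (hb : 0 ≤ b) :
    (∫⁻ h, ENNReal.ofReal h ∂F) *
        (2 * (∫⁻ t in Set.Icc 0 b, renewalOvershoot F ENNReal.ofReal n t) +
          renewalOvershoot F (fun x => ENNReal.ofReal x ^ 2) n b) ≤
      (∫⁻ h, ENNReal.ofReal (|h| ^ 2) ∂F) *
        (renewalOvershoot F ENNReal.ofReal n b + ENNReal.ofReal b) := by
  set h1 := ∫⁻ h, ENNReal.ofReal h ∂F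
  set h2 := ∫⁻ h, ENNReal.ofReal (|h| ^ 2) ∂F
  induction n generalizing b with
  | zero => simp [renewalOvershoot]
  | succ n ih =>
    set R := renewalOvershoot F ENNReal.ofReal n with hR
    set W := renewalOvershoot F (fun x => ENNReal.ofReal x ^ 2) n with hW
    have hRm : Measurable R := measurable_renewalOvershoot F ENNReal.measurable_ofReal n
    have hWm : Measurable W := measurable_renewalOvershoot F (by fun_prop) n
    have hKm : Measurable fun c : ℝ => ∫⁻ t in Set.Icc 0 c, R t := by
      have : (fun c : ℝ => ∫⁻ t in Set.Icc 0 c, R t) =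
          fun c => ∫⁻ t, {p : ℝ × ℝ | 0 ≤ p.2 ∧ p.2 ≤ p.1}.indicator (fun p => R p.2) (c, t) := by
        funext c
        rw [← lintegral_indicator measurableSet_Icc]
        rfl
      rw [this]
      exact ((hRm.comp measurable_snd).indicator (by measurability)).lintegral_prod_right'
    have hK : 2 * (∫⁻ t in Set.Icc 0 b, renewalOvershoot F ENNReal.ofReal (n + 1) t) +
        renewalOvershoot F (fun x => ENNReal.ofReal x ^ 2) (n + 1) b ≤
        h2 + ∫⁻ h, (if h ≤ b then 2 * (∫⁻ t in Set.Icc 0 (b - h), R t) + W (b - h) else 0) ∂F := by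
      have hm := measurable_renewalOvershoot_step ENNReal.measurable_ofReal hRm
      simp only [renewalOvershoot]
      rw [lintegral_lintegral_swap (f := fun t h => if h ≤ t then R (t - h)
        else ENNReal.ofReal (h - t)) hm.aemeasurable, ← lintegral_const_mul _
        (by exact (hm.comp measurable_swap).lintegral_prod_right'),
        ← lintegral_add_left (by
          exact ((hm.comp measurable_swap).lintegral_prod_right').const_mul _),
        ← lintegral_add_left (by fun_prop)]
      refine lintegral_mono_ae ?_
      filter_upwards [hF] with h hh
      refine (add_le_add_left (two_mul_lintegral_step_le R hh hb) _).trans ?_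
      rw [abs_of_pos hh]
      split_ifs with hhb
      · rw [add_assoc]
      · rw [add_zero, ← ENNReal.ofReal_pow (by linarith), ← ENNReal.ofReal_add (by nlinarith)
          (by positivity)]
        exact ENNReal.ofReal_le_ofReal (by linarith)
    have hr : renewalOvershoot F ENNReal.ofReal (n + 1) b + ENNReal.ofReal b =
        h1 + ∫⁻ h, (if h ≤ b then R (b - h) + ENNReal.ofReal (b - h) else 0) ∂F := by
      have : ENNReal.ofReal b = ∫⁻ _, ENNReal.ofReal b ∂F := by simp
      rw [renewalOvershoot, this, ← lintegral_add_right _ measurable_const,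
        ← lintegral_add_left (by fun_prop)]
      refine lintegral_congr_ae ?_
      filter_upwards [hF] with h hh
      split_ifs with hhb
      · rw [add_left_comm, ← ENNReal.ofReal_add hh.le (by linarith)]
        congr 2; ring
      · rw [add_zero, ← ENNReal.ofReal_add (by linarith) hb]
        congr 1; ring
    rw [hr]
    refine (mul_le_mul_right hK _).trans ?_
    rw [mul_add, mul_add, mul_comm h1 h2]
    refine add_le_add_right ?_ _
    have hm : Measurable fun h : ℝ => 2 * (∫⁻ t in Set.Icc 0 (b - h), R t) + W (b - h) :=
      ((hKm.const_mul 2).add hWm).comp (measurable_const.sub measurable_id)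
    rw [← lintegral_const_mul _ (Measurable.ite measurableSet_Iic hm measurable_const),
      ← lintegral_const_mul _ (Measurable.ite measurableSet_Iic (by fun_prop) measurable_const)]
    refine lintegral_mono fun h => ?_
    dsimp only
    split_ifs with hhb
    · exact ih (by linarith)
    · simp

/-- Lorden's inequality `E R_b ≤ E H² / E H` for the overshoot of a renewal process. -/
theorem renewalOvershoot_mul_le (hF : ∀ᵐ x ∂F, 0 < x) (hfin : ∫⁻ h, ENNReal.ofReal h ∂F ≠ ⊤)
    (n : ℕ) {b : ℝ} (hb : 0 ≤ b) :
    renewalOvershoot F ENNReal.ofReal n b * ∫⁻ h, ENNReal.ofReal h ∂F ≤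
      ∫⁻ h, ENNReal.ofReal (|h| ^ 2) ∂F := by
  set R := renewalOvershoot F ENNReal.ofReal n with hR
  have hRm : Measurable R := measurable_renewalOvershoot F ENNReal.measurable_ofReal n
  -- Subadditivity R_b ≤ R_t + R_{b-t}, integrated over t in [0, b].
  have h1 : ENNReal.ofReal b * R b ≤ 2 * ∫⁻ t in Set.Icc 0 b, R t := by
    calc ENNReal.ofReal b * R b = ∫⁻ _ in Set.Icc 0 b, R b := by
          rw [lintegral_const, Measure.restrict_apply_univ, Real.volume_Icc, sub_zero, mul_comm]
      _ ≤ ∫⁻ t in Set.Icc 0 b, (R t + R (b - t)) := by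
          refine setLIntegral_mono' measurableSet_Icc fun t ht => ?_
          have := renewalOvershoot_add_le F n (s := t) (t := b - t) (by linarith [ht.2])
          rwa [add_sub_cancel] at this
      _ = 2 * ∫⁻ t in Set.Icc 0 b, R t := by
          rw [lintegral_add_left hRm, lintegral_Icc_sub_left, two_mul]
  have h2 := lorden_identity_le F hF n hb
  -- Jensen replaces the second moment of the overshoot by R_b², so that R_b + b becomes a common
  -- factor.
  have h3 : (∫⁻ h, ENNReal.ofReal h ∂F) * ((R b + ENNReal.ofReal b) * R b) ≤
      (∫⁻ h, ENNReal.ofReal (|h| ^ 2) ∂F) * (R b + ENNReal.ofReal b) := by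
    refine le_trans (mul_le_mul_right ?_ _) h2
    rw [add_mul, add_comm, ← sq]
    exact add_le_add h1 (renewalOvershoot_sq_le F n b)
  have hRfin : R b ≠ ⊤ := renewalOvershoot_ne_top F hfin n hb
  rcases eq_or_ne (R b + ENNReal.ofReal b) 0 with h0 | h0
  · rw [(add_eq_zero.1 h0).1, zero_mul]
    exact zero_le
  · refine (ENNReal.mul_le_mul_iff_left h0 (ENNReal.add_ne_top.2
      ⟨hRfin, ENNReal.ofReal_ne_top⟩)).1 (le_of_eq_of_le ?_ h3)
    ring

end Mean

/-! ### Comparison of the exit position with the renewal process of ladder heights -/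

/-- The expectation of `g` at the first position in `(0, ∞)` of the walk started at `x`, on the
event that it is reached within `n` steps. -/
def firstPassage (ν : Measure ℝ) (g : ℝ → ℝ≥0∞) : ℕ → ℝ → ℝ≥0∞
  | 0, _ => 0
  | n + 1, x => ∫⁻ y, (if 0 < x + y then g (x + y) else firstPassage ν g n (x + y)) ∂ν

theorem measurable_firstPassage_step {g ψ : ℝ → ℝ≥0∞} (hg : Measurable g) (hψ : Measurable ψ) :
    Measurable fun z : ℝ => if 0 < z then g z else ψ z :=
  Measurable.ite measurableSet_Ioi hg hψ

theorem measurable_firstPassage (ν : Measure ℝ) [SFinite ν] {g : ℝ → ℝ≥0∞} (hg : Measurable g)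
    (n : ℕ) : Measurable (firstPassage ν g n) := by
  induction n with
  | zero => exact measurable_const
  | succ n ih =>
    exact ((measurable_firstPassage_step hg ih).comp
      (measurable_fst.add measurable_snd)).lintegral_prod_right'

theorem firstPassage_mono (ν : Measure ℝ) (g : ℝ → ℝ≥0∞) : Monotone (firstPassage ν g) := by
  refine monotone_nat_of_le_succ fun n => ?_
  induction n with
  | zero => exact fun _ => zero_le
  | succ n ih =>
    refine fun x => lintegral_mono fun y => ?_
    dsimp only
    split_ifs
    · exact le_rfl
    · exact ih _

theorem lintegral_firstPassage_le (ν : Measure ℝ) [IsFiniteMeasure ν] {g : ℝ → ℝ≥0∞}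
    (hg : Measurable g) (m n : ℕ) :
    ∫⁻ x, firstPassage ν g m x ∂(killedLaw ν (Set.Iic 0) n) ≤
      ∑ k ∈ Finset.range m, ∫⁻ x, g x ∂(exitLawAt ν (Set.Iic 0) (n + k)) := by
  induction m generalizing n with
  | zero => simp [firstPassage]
  | succ m ih =>
    have hm := measurable_firstPassage_step hg (measurable_firstPassage ν hg m)
    simp only [firstPassage]
    rw [← lintegral_killedLaw_succ_add ν measurableSet_Iic n hm, Finset.sum_range_succ', add_zero]
    refine add_le_add ?_ ?_
    · refine (lintegral_mono_ae ?_).trans ((ih (n + 1)).trans_eq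
        (Finset.sum_congr rfl fun k _ => by rw [show n + 1 + k = n + (k + 1) by omega]))
      filter_upwards [killedLaw_succ_ae_mem ν measurableSet_Iic n] with x hx
      rw [if_neg (not_lt.2 hx)]
    · refine lintegral_mono_ae ?_
      filter_upwards [ae_restrict_mem measurableSet_Iic.compl] with x hx
      rw [if_pos (by simpa using hx)]

theorem firstPassage_zero_le (ν : Measure ℝ) [IsFiniteMeasure ν] {g : ℝ → ℝ≥0∞}
    (hg : Measurable g) (n : ℕ) :
    firstPassage ν g n 0 ≤ ∫⁻ x, g x ∂(exitLaw ν (Set.Iic 0)) := by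
  have h := lintegral_firstPassage_le ν hg n 0
  rw [killedLaw_zero, lintegral_dirac' _ (measurable_firstPassage ν hg n)] at h
  simp only [zero_add] at h
  rw [exitLaw, lintegral_sum_measure]
  exact h.trans (ENNReal.sum_le_tsum _)

/-- To pass b ≥ 0 the walk must first enter (0, ∞), at some h, and then climb b - h if h ≤ b.
Reaching h uses at least one step, so a budget of N ≥ n - 1 further steps is enough. -/
theorem firstPassage_ladder_le (ν : Measure ℝ) (N n : ℕ) (hn : n ≤ N + 1) {b : ℝ} (hb : 0 ≤ b)
    (x : ℝ) :
    firstPassage ν ENNReal.ofReal n (x - b) ≤ firstPassage ν (fun h => if h ≤ b then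
      firstPassage ν ENNReal.ofReal N (h - b) else ENNReal.ofReal (h - b)) n x := by
  induction n generalizing x with
  | zero => exact zero_le
  | succ n ih =>
    refine lintegral_mono fun y => ?_
    dsimp only
    rw [show x - b + y = x + y - b by ring]
    split_ifs with h1 h2 h3 h4 h5
    · linarith
    · exact le_rfl
    · linarith
    · exact firstPassage_mono ν _ (by omega) _
    · linarith
    · exact ih (by omega) _

/-- Iterates the ladder decomposition: each ladder height is one renewal step, and n steps of the
walk contain at most n ladder epochs. -/
theorem firstPassage_le_renewalOvershoot (ν : Measure ℝ) [IsFiniteMeasure ν] (n : ℕ) {b : ℝ}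
    (hb : 0 ≤ b) :
    firstPassage ν ENNReal.ofReal n (-b) ≤
      renewalOvershoot (exitLaw ν (Set.Iic 0)) ENNReal.ofReal n b := by
  induction n generalizing b with
  | zero => exact zero_le
  | succ n ih =>
    have h := firstPassage_ladder_le ν n (n + 1) le_rfl hb 0
    rw [zero_sub] at h
    have hm := measurable_firstPassage ν ENNReal.measurable_ofReal n
    refine (h.trans (firstPassage_zero_le ν (Measurable.ite measurableSet_Iic (by fun_prop)
      (by fun_prop)) _)).trans (lintegral_mono fun y => ?_)
    dsimp only
    split_ifs with h1
    · rw [← neg_sub]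
      exact ih (by linarith)
    · exact le_rfl

/-- Compares the killed walk with the unrestricted one. An exit above A is also the first passage of
A, and any other exit contributes 0 through `ENNReal.ofReal`; m counts the steps left after time n.
-/
theorem sum_lintegral_exitLawAt_le (ν : Measure ℝ) [IsFiniteMeasure ν] {S : Set ℝ} {A : ℝ}
    (hS : MeasurableSet S) (hSA : S ⊆ Set.Iic A) (m n : ℕ) :
    ∑ k ∈ Finset.range n, ∫⁻ y, ENNReal.ofReal (y - A) ∂(exitLawAt ν S k) +
      ∫⁻ x, firstPassage ν ENNReal.ofReal m (x - A) ∂(killedLaw ν S n) ≤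
      firstPassage ν ENNReal.ofReal (n + m) (-A) := by
  induction n generalizing m with
  | zero =>
    have hm := measurable_firstPassage ν ENNReal.measurable_ofReal m
    rw [killedLaw_zero, lintegral_dirac' _ (by fun_prop)]
    simp
  | succ n ih =>
    have hm := (measurable_firstPassage_step ENNReal.measurable_ofReal
      (measurable_firstPassage ν ENNReal.measurable_ofReal m)).comp
        (measurable_id.sub_const A)
    rw [add_assoc n 1 m, add_comm 1 m]
    refine le_trans ?_ (ih (m + 1))
    rw [Finset.sum_range_succ, add_assoc]
    refine add_le_add_right ?_ _
    have e : ∫⁻ x, firstPassage ν ENNReal.ofReal (m + 1) (x - A) ∂(killedLaw ν S n) =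
        ∫⁻ x, ∫⁻ y, (if 0 < x + y - A then ENNReal.ofReal (x + y - A) else
          firstPassage ν ENNReal.ofReal m (x + y - A)) ∂ν ∂(killedLaw ν S n) := by
      simp only [firstPassage, sub_add_eq_add_sub]
    rw [e, add_comm]
    refine le_trans (add_le_add ?_ ?_) (lintegral_killedLaw_succ_add ν hS n hm).le
    · refine lintegral_mono_ae ?_
      filter_upwards [killedLaw_succ_ae_mem ν hS n] with x hx
      have : ¬ 0 < x - A := by linarith [Set.mem_Iic.1 (hSA hx)]
      simp [this]
    · refine lintegral_mono fun x => ?_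
      by_cases h : 0 < x - A
      · simp [h]
      · simp [ENNReal.ofReal_of_nonpos (not_lt.1 h)]

/-! ### Overshoot bounds from the first two ladder height moments -/

section Bounds

variable (ν : Measure ℝ) [IsProbabilityMeasure ν] {S : Set ℝ} {A : ℝ}

theorem lintegral_overshoot_mul_le (hint : Integrable (fun y => y) ν) (hpos : 0 < ∫ y, y ∂ν)
    (hS : MeasurableSet S) (hSA : S ⊆ Set.Iic A) (hA : 0 ≤ A) :
    (∫⁻ y, ENNReal.ofReal (y - A) ∂(exitLaw ν S)) *
        ∫⁻ x, ENNReal.ofReal x ∂(exitLaw ν (Set.Iic 0)) ≤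
      ∫⁻ x, ENNReal.ofReal (|x| ^ 2) ∂(exitLaw ν (Set.Iic 0)) := by
  have := isProbabilityMeasure_exitLaw_Iic ν hint hpos
  have hfin : ∫⁻ x, ENNReal.ofReal x ∂(exitLaw ν (Set.Iic 0)) ≠ ⊤ :=
    ne_top_of_le_ne_top (ENNReal.mul_ne_top (greenLaw_Iic_univ_ne_top ν hint hpos)
      hint.lintegral_lt_top.ne) (lintegral_exitLaw_Iic_le ν ENNReal.measurable_ofReal
        ENNReal.ofReal_mono)
  rw [exitLaw, lintegral_sum_measure, ENNReal.tsum_eq_iSup_nat, ENNReal.iSup_mul]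
  refine iSup_le fun n => ?_
  refine le_trans ?_ (renewalOvershoot_mul_le _ (isWienerHopf_exitLaw ν).pos hfin n hA)
  gcongr
  exact (le_self_add.trans (sum_lintegral_exitLawAt_le ν hS hSA 0 n)).trans
    (firstPassage_le_renewalOvershoot ν n hA)

/-- Reduces an overshoot bound to a bound on E H² / E H. Cancelling E H is legitimate because 0 < E
X ≤ E H < ∞. -/
theorem lintegral_overshoot_mul_le_of_ladder (hint : Integrable (fun y => y) ν)
    (hpos : 0 < ∫ y, y ∂ν) (hS : MeasurableSet S) (hSA : S ⊆ Set.Iic A) (hA : 0 ≤ A)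
    {a c : ℝ≥0∞}
    (h : (∫⁻ x, ENNReal.ofReal (|x| ^ 2) ∂(exitLaw ν (Set.Iic 0))) * a ≤
      c * ∫⁻ x, ENNReal.ofReal x ∂(exitLaw ν (Set.Iic 0))) :
    (∫⁻ y, ENNReal.ofReal (y - A) ∂(exitLaw ν S)) * a ≤ c := by
  have hfin : ∫⁻ x, ENNReal.ofReal x ∂(exitLaw ν (Set.Iic 0)) ≠ ⊤ :=
    ne_top_of_le_ne_top (ENNReal.mul_ne_top (greenLaw_Iic_univ_ne_top ν hint hpos)
      hint.lintegral_lt_top.ne) (lintegral_exitLaw_Iic_le ν ENNReal.measurable_ofReal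
        ENNReal.ofReal_mono)
  have h0 : ∫⁻ x, ENNReal.ofReal x ∂(exitLaw ν (Set.Iic 0)) ≠ 0 := by
    have h1 : killedLaw ν (Set.Iic 0) 0 Set.univ ≤ greenLaw ν (Set.Iic 0) Set.univ :=
      Measure.le_iff'.1 (Measure.le_sum _ 0) _
    rw [killedLaw_zero, measure_univ] at h1
    have h2 := (mul_le_mul_right h1 (ENNReal.ofReal (∫ y, y ∂ν))).trans
      (drift_mul_greenLaw_le ν hint hpos)
    rw [mul_one] at h2
    exact ((ENNReal.ofReal_pos.2 hpos).trans_le h2).ne'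
  refine (ENNReal.mul_le_mul_iff_left h0 hfin).1 (le_trans ?_ h)
  rw [mul_right_comm]
  gcongr
  exact lintegral_overshoot_mul_le ν hint hpos hS hSA hA

/-- Lorden's bound for the overshoot. -/
theorem lintegral_overshoot_le_div_mean (hint : Integrable (fun y => y) ν)
    (hpos : 0 < ∫ y, y ∂ν) (hS : MeasurableSet S) (hSA : S ⊆ Set.Iic A) (hA : 0 ≤ A) :
    ∫⁻ y, ENNReal.ofReal (y - A) ∂(exitLaw ν S) ≤
      (∫⁻ y, ENNReal.ofReal ((max 0 y) ^ 2) ∂ν) / ENNReal.ofReal (∫ y, y ∂ν) := by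
  rw [ENNReal.le_div_iff_mul_le (Or.inl (ENNReal.ofReal_pos.2 hpos).ne')
    (Or.inl ENNReal.ofReal_ne_top)]
  exact lintegral_overshoot_mul_le_of_ladder ν hint hpos hS hSA hA
    (ladder_sq_moment_mul_le ν hint hpos)

/-- The bound for the overshoot that does not degenerate for small drift. -/
theorem lintegral_overshoot_le_div_sq_moment (hint : Integrable (fun y => y) ν)
    (hpos : 0 < ∫ y, y ∂ν) (h3 : Integrable (fun y => |y| ^ 3) ν) (hS : MeasurableSet S)
    (hSA : S ⊆ Set.Iic A) (hA : 0 ≤ A) :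
    ∫⁻ y, ENNReal.ofReal (y - A) ∂(exitLaw ν S) ≤
      3 * (∫⁻ y, ENNReal.ofReal (|y| ^ 3) ∂ν) / ∫⁻ y, ENNReal.ofReal (y ^ 2) ∂ν := by
  have := isProbabilityMeasure_exitLaw_Iic ν hint hpos
  have hne : ∫⁻ y, ENNReal.ofReal (y ^ 2) ∂ν ≠ 0 := by
    intro h0
    rw [lintegral_eq_zero_iff (by fun_prop)] at h0
    refine hpos.ne' (integral_eq_zero_of_ae ?_)
    filter_upwards [h0] with y hy
    have : y ^ 2 ≤ 0 := ENNReal.ofReal_eq_zero.1 hy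
    exact pow_eq_zero_iff two_ne_zero |>.1 (le_antisymm this (sq_nonneg y))
  rw [ENNReal.le_div_iff_mul_le (Or.inl hne) (Or.inr (ENNReal.mul_ne_top ENNReal.ofNat_ne_top
    h3.lintegral_lt_top.ne))]
  have h := (isWienerHopf_exitLaw ν).sq_moment_mul_le
  simp only [sq_abs] at h
  refine (lintegral_overshoot_mul_le_of_ladder ν hint hpos hS hSA hA (by simpa only [sq_abs] using h)).trans ?_
  -- The moment comparison gives the constant 2, and 2 ≤ 3.
  exact mul_le_mul' (by norm_num) le_rfl

end Bounds

/-! ### Mean excess bounds -/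

theorem lintegral_cond_mul (ν : Measure ℝ) [IsFiniteMeasure ν] {s : Set ℝ}
    (hs : MeasurableSet s) {f : ℝ → ℝ≥0∞} (hf : ∀ x ∉ s, f x = 0) :
    ∫⁻ x, f x ∂ν = (∫⁻ x, f x ∂(ν[|s])) * ν s := by
  have h1 : ∫⁻ x, f x ∂ν = ∫⁻ x in s, f x ∂ν := by
    rw [← lintegral_indicator hs]
    refine lintegral_congr fun x => ?_
    by_cases hx : x ∈ s
    · rw [Set.indicator_of_mem hx]
    · rw [Set.indicator_of_notMem hx, hf x hx]
  rw [h1, ProbabilityTheory.cond, lintegral_smul_measure, smul_eq_mul]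
  rcases eq_or_ne (ν s) 0 with h0 | h0
  · rw [h0, mul_zero, Measure.restrict_eq_zero.2 h0, lintegral_zero_measure]
  · rw [mul_right_comm, ENNReal.inv_mul_cancel h0 (measure_ne_top _ _), one_mul]

/-- `posMeanExcess` conditions on X ≥ x, whereas an exit requires X > t. The level t is therefore
approached from above by t + 1/(n+1). -/
theorem lintegral_sub_le_posMeanExcess (ν : Measure ℝ) [IsFiniteMeasure ν] {t : ℝ}
    (ht : 0 ≤ t) :
    ∫⁻ y, ENNReal.ofReal (y - t) ∂ν ≤ posMeanExcess ν * ν (Set.Ioi t) := by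
  have hlim : Filter.Tendsto (fun n : ℕ => ∫⁻ y, ENNReal.ofReal (y - (t + 1 / ((n : ℝ) + 1))) ∂ν)
      Filter.atTop (nhds (∫⁻ y, ENNReal.ofReal (y - t) ∂ν)) := by
    refine lintegral_tendsto_of_tendsto_of_monotone (fun n => by fun_prop)
      (ae_of_all _ fun y m n hmn => ?_) (ae_of_all _ fun y => ?_)
    · refine ENNReal.ofReal_le_ofReal ?_
      have := one_div_le_one_div_of_le (by positivity : (0 : ℝ) < (m : ℝ) + 1)
        (by gcongr : (m : ℝ) + 1 ≤ (n : ℝ) + 1)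
      linarith
    · refine ENNReal.tendsto_ofReal ?_
      simpa using (tendsto_one_div_add_atTop_nhds_zero_nat (𝕜 := ℝ)).const_add t |>.const_sub y
  refine le_of_tendsto' hlim fun n => ?_
  have hn : (0 : ℝ) < 1 / ((n : ℝ) + 1) := by positivity
  rw [lintegral_cond_mul ν (s := Set.Ici (t + 1 / ((n : ℝ) + 1))) measurableSet_Ici
    fun y hy => ENNReal.ofReal_of_nonpos (by rw [Set.mem_Ici, not_le] at hy; linarith)]
  refine mul_le_mul' ?_ (measure_mono fun y hy => ?_)
  · exact le_iSup₂_of_le (t + 1 / ((n : ℝ) + 1)) (by positivity) le_rfl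
  · exact Set.mem_Ioi.2 (by linarith [Set.mem_Ici.1 hy])

theorem lintegral_neg_le_negMeanExcess (ν : Measure ℝ) [IsFiniteMeasure ν] {t : ℝ}
    (ht : 0 ≤ t) :
    ∫⁻ y, ENNReal.ofReal (-(y + t)) ∂ν ≤ negMeanExcess ν * ν (Set.Iio (-t)) := by
  rw [lintegral_cond_mul ν (s := Set.Iio (-t)) measurableSet_Iio
    fun y hy => ENNReal.ofReal_of_nonpos (by rw [Set.mem_Iio, not_lt] at hy; linarith)]
  refine mul_le_mul' ?_ le_rfl
  exact le_iSup₂_of_le t ht le_rfl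

/-- Decomposition at the position just before the exit: a one-step bound uniform over x ∈ `S` is
integrated against each killed law and summed over time. -/
theorem lintegral_exitLaw_le_mul (ν : Measure ℝ) [IsProbabilityMeasure ν] {S U : Set ℝ}
    (hS : MeasurableSet S) (h0 : (0 : ℝ) ∈ S) (hU : MeasurableSet U) (hSU : Disjoint S U)
    {f : ℝ → ℝ≥0∞} (hf : Measurable f) (hfS : ∀ x ∈ S, f x = 0) {c : ℝ≥0∞}
    (h : ∀ x ∈ S, ∫⁻ y, f (x + y) ∂ν ≤ c * ν {y | x + y ∈ U}) :
    ∫⁻ x, f x ∂(exitLaw ν S) ≤ c * exitLaw ν S U := by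
  rw [exitLaw, lintegral_sum_measure, Measure.sum_apply _ hU, ← ENNReal.tsum_mul_left]
  refine ENNReal.tsum_le_tsum fun n => ?_
  have key (g : ℝ → ℝ≥0∞) (hg : Measurable g) (hgS : ∀ x ∈ S, g x = 0) :
      ∫⁻ x, g x ∂(exitLawAt ν S n) = ∫⁻ x, ∫⁻ y, g (x + y) ∂ν ∂(killedLaw ν S n) := by
    have h1 : ∫⁻ x, g x ∂(killedLaw ν S (n + 1)) = 0 := by
      rw [lintegral_eq_zero_iff hg]
      filter_upwards [killedLaw_succ_ae_mem ν hS n] with x hx using hgS x hx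
    rw [← lintegral_killedLaw_succ_add ν hS n hg, h1, zero_add]
  rw [key f hf hfS, ← lintegral_indicator_one hU, key _ (measurable_one.indicator hU)
    fun x hx => Set.indicator_of_notMem (Set.disjoint_left.1 hSU hx) _,
    ← lintegral_const_mul _ (by
      exact (((measurable_one.indicator hU).comp
        (measurable_fst.add measurable_snd)).lintegral_prod_right'))]
  refine lintegral_mono_ae ?_
  filter_upwards [killedLaw_ae_mem ν hS h0 n] with x hx
  exact (h x hx).trans_eq (congrArg _
    (lintegral_indicator_one (hU.preimage (measurable_const_add x))).symm)

theorem lintegral_exitLaw_le_posMeanExcess (ν : Measure ℝ) [IsProbabilityMeasure ν] {A B : ℝ}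
    (hA : 0 ≤ A) (hB : 0 ≤ B) :
    ∫⁻ y, ENNReal.ofReal (y - A) ∂(exitLaw ν (Set.Icc (-B) A)) ≤
      posMeanExcess ν * exitLaw ν (Set.Icc (-B) A) (Set.Ioi A) := by
  refine lintegral_exitLaw_le_mul ν measurableSet_Icc ⟨by linarith, hA⟩ measurableSet_Ioi
    (Set.disjoint_left.2 fun x hx hx' => not_le.2 hx' hx.2) (by fun_prop)
    (fun x hx => ENNReal.ofReal_of_nonpos (by linarith [hx.2])) fun x hx => ?_
  have h := lintegral_sub_le_posMeanExcess ν (t := A - x) (by linarith [hx.2])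
  convert! h using 3
  · congr 1; ring
  · ext y; simp [sub_lt_iff_lt_add']

theorem lintegral_exitLaw_le_negMeanExcess (ν : Measure ℝ) [IsProbabilityMeasure ν] {A B : ℝ}
    (hA : 0 ≤ A) (hB : 0 ≤ B) :
    ∫⁻ y, ENNReal.ofReal (-(y + B)) ∂(exitLaw ν (Set.Icc (-B) A)) ≤
      negMeanExcess ν * exitLaw ν (Set.Icc (-B) A) (Set.Iio (-B)) := by
  refine lintegral_exitLaw_le_mul ν measurableSet_Icc ⟨by linarith, hA⟩ measurableSet_Iio
    (Set.disjoint_left.2 fun x hx hx' => not_le.2 hx' hx.1) (by fun_prop)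
    (fun x hx => ENNReal.ofReal_of_nonpos (by linarith [hx.1])) fun x hx => ?_
  have h := lintegral_neg_le_negMeanExcess ν (t := x + B) (by linarith [hx.1])
  convert! h using 3
  · congr 1; ring
  · ext y
    simp only [Set.mem_Iio, Set.mem_ofPred_eq]
    constructor <;> intro h <;> linarith

/-- The mean overshoot on the upper exit is bounded by the overshoot parameter. -/
theorem lintegral_exitLaw_le_overshootParam (ν : Measure ℝ) [IsProbabilityMeasure ν] {A B : ℝ}
    (hA : 0 ≤ A) (hB : 0 ≤ B) (hint : Integrable (fun y => y) ν) (hpos : 0 < ∫ y, y ∂ν)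
    (h3 : Integrable (fun y => |y| ^ 3) ν) :
    ∫⁻ y, ENNReal.ofReal (y - A) ∂(exitLaw ν (Set.Icc (-B) A)) ≤ overshootParam ν := by
  refine le_min (le_min ?_ ?_) ?_
  · exact lintegral_overshoot_le_div_mean ν hint hpos measurableSet_Icc Set.Icc_subset_Iic_self hA
  · exact lintegral_overshoot_le_div_sq_moment ν hint hpos h3 measurableSet_Icc
      Set.Icc_subset_Iic_self hA
  · refine (lintegral_exitLaw_le_posMeanExcess ν hA hB).trans (mul_le_of_le_one_right' ?_)
    exact (measure_mono (Set.subset_univ _)).trans (exitLaw_univ_le_one ν measurableSet_Icc)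

/-- Steps of size at least some δ > 0 have positive probability. If the upper exit were null, a run
of n such steps would stay in the interval with positive probability, which is impossible once nδ >
A. -/
theorem exitLaw_Ioi_pos (ν : Measure ℝ) [IsProbabilityMeasure ν] {A B : ℝ}
    (hB : 0 ≤ B) (hpos : 0 < ∫ y, y ∂ν) :
    0 < exitLaw ν (Set.Icc (-B) A) (Set.Ioi A) := by
  by_contra hcon
  have hzero : exitLaw ν (Set.Icc (-B) A) (Set.Ioi A) = 0 := by simpa using hcon
  obtain ⟨δ, hδ, hνδ⟩ : ∃ δ : ℝ, 0 < δ ∧ ν (Set.Ici δ) ≠ 0 := by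
    by_contra! h
    have h0 : ν (Set.Ioi 0) = 0 := by
      have : Set.Ioi (0 : ℝ) = ⋃ n : ℕ, Set.Ici (1 / ((n : ℝ) + 1)) := by
        ext y
        simp only [Set.mem_Ioi, Set.mem_iUnion, Set.mem_Ici]
        exact ⟨fun hy => (exists_nat_one_div_lt hy).imp fun n hn => hn.le,
          fun ⟨n, hn⟩ => lt_of_lt_of_le (by positivity) hn⟩
      rw [this, measure_iUnion_null_iff]
      exact fun n => h _ (by positivity)
    refine hpos.not_ge (integral_nonpos_of_ae ?_)
    filter_upwards [measure_eq_zero_iff_ae_notMem.1 h0] with y hy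
    exact not_lt.1 hy
  have step (n : ℕ) : killedLaw ν (Set.Icc (-B) A) n (Set.Ici (n * δ)) ≠ 0 := by
    induction n with
    | zero => simp [killedLaw_zero]
    | succ n ih =>
      set κ := killedLaw ν (Set.Icc (-B) A) n
      have h1 : κ (Set.Ici (n * δ)) * ν (Set.Ici δ) ≤ (κ ∗ ν) (Set.Ici ((n + 1 : ℕ) * δ)) := by
        rw [Measure.conv, Measure.map_apply (by fun_prop) measurableSet_Ici, ← Measure.prod_prod]
        refine measure_mono fun p hp => ?_
        have := Set.mem_Ici.1 hp.1
        have := Set.mem_Ici.1 hp.2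
        simp only [Set.mem_preimage, Set.mem_Ici]
        push_cast
        linarith
      have h2 : (κ ∗ ν) (Set.Ioi A) = 0 := by
        have h3 := (Measure.sum_apply_eq_zero' measurableSet_Ioi).1 hzero n
        rw [exitLawAt, Measure.restrict_apply measurableSet_Ioi] at h3
        have h4 : Set.Ioi A ∩ (Set.Icc (-B) A)ᶜ = Set.Ioi A :=
          Set.inter_eq_left.2 fun x hx hx' => not_le.2 (Set.mem_Ioi.1 hx) hx'.2
        rwa [h4] at h3
      rw [killedLaw_succ, Measure.restrict_apply measurableSet_Ici]
      intro h4
      have h5 : (κ ∗ ν) (Set.Ici ((n + 1 : ℕ) * δ)) = 0 := by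
        refine measure_mono_null (fun x hx => ?_) (measure_union_null h4 h2)
        rcases le_or_gt x A with hxA | hxA
        · refine Or.inl ⟨hx, ?_, hxA⟩
          have : (0 : ℝ) ≤ (n + 1 : ℕ) * δ := by positivity
          linarith [Set.mem_Ici.1 hx]
        · exact Or.inr hxA
      exact mul_ne_zero ih hνδ (le_antisymm (h1.trans h5.le) zero_le)
  obtain ⟨n, hn⟩ := exists_nat_gt (A / δ)
  have hn' : A < (n + 1 : ℕ) * δ := by
    rw [div_lt_iff₀ hδ] at hn
    push_cast
    linarith
  refine step (n + 1) ?_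
  rw [killedLaw_succ, Measure.restrict_apply measurableSet_Ici]
  have : Set.Ici ((n + 1 : ℕ) * δ) ∩ Set.Icc (-B) A = ∅ :=
    Set.eq_empty_of_forall_notMem fun x hx => by linarith [Set.mem_Ici.1 hx.1, hx.2.2]
  rw [this, measure_empty]

/-! ### Reflection and exponential tilting of the exit law -/

theorem map_neg_conv_map_neg (μ ν : Measure ℝ) [SFinite μ] [SFinite ν] :
    (μ.map fun x => -x) ∗ (ν.map fun x => -x) = (μ ∗ ν).map fun x => -x :=
  (Measure.map_conv_addMonoidHom (negAddMonoidHom (α := ℝ)) measurable_neg).symm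

theorem neg_preimage_neg_preimage (S : Set ℝ) :
    (fun x : ℝ => -x) ⁻¹' ((fun x : ℝ => -x) ⁻¹' S) = S := by
  ext x; simp

theorem killedLaw_map_neg (ν : Measure ℝ) [IsFiniteMeasure ν] {S : Set ℝ} (hS : MeasurableSet S)
    (n : ℕ) : killedLaw (ν.map fun x => -x) ((fun x => -x) ⁻¹' S) n =
      (killedLaw ν S n).map fun x => -x := by
  induction n with
  | zero => rw [killedLaw_zero, killedLaw_zero, Measure.map_dirac' (by fun_prop), neg_zero]
  | succ n ih =>
    rw [killedLaw_succ, killedLaw_succ, ih, map_neg_conv_map_neg,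
      Measure.restrict_map measurable_neg (hS.preimage measurable_neg), neg_preimage_neg_preimage]

theorem lintegral_exitLaw_map_neg (ν : Measure ℝ) [IsFiniteMeasure ν] {S : Set ℝ}
    (hS : MeasurableSet S) {f : ℝ → ℝ≥0∞} (hf : Measurable f) :
    ∫⁻ x, f x ∂(exitLaw (ν.map fun x => -x) ((fun x => -x) ⁻¹' S)) =
      ∫⁻ x, f (-x) ∂(exitLaw ν S) := by
  rw [exitLaw, exitLaw, lintegral_sum_measure, lintegral_sum_measure]
  refine tsum_congr fun n => ?_
  rw [exitLawAt, killedLaw_map_neg ν hS, map_neg_conv_map_neg, ← Set.preimage_compl,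
    Measure.restrict_map measurable_neg (hS.compl.preimage measurable_neg),
    neg_preimage_neg_preimage, lintegral_map hf measurable_neg]
  rfl

/-- With e(x) = e^{-λx}, tilting the step law tilts every killed and exit law by the same function
of the position. -/
theorem withDensity_conv_withDensity (μ ν : Measure ℝ) [IsFiniteMeasure μ] [IsFiniteMeasure ν]
    {e : ℝ → ℝ≥0∞} (he : Measurable e) (hadd : ∀ x y, e (x + y) = e x * e y) (hfin : ∀ x, e x ≠ ⊤) :
    μ.withDensity e ∗ ν.withDensity e = (μ ∗ ν).withDensity e := by
  have := SigmaFinite.withDensity_of_ne_top (μ := ν) (f := e) (ae_of_all _ hfin)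
  refine Measure.ext_of_lintegral _ fun f hf => ?_
  rw [Measure.lintegral_conv hf, lintegral_withDensity_eq_lintegral_mul _ he (by fun_prop),
    lintegral_withDensity_eq_lintegral_mul _ he hf, Measure.lintegral_conv (by fun_prop)]
  refine lintegral_congr fun x => ?_
  rw [Pi.mul_apply, lintegral_withDensity_eq_lintegral_mul _ he (by fun_prop),
    ← lintegral_const_mul _ (by fun_prop)]
  refine lintegral_congr fun y => ?_
  simp only [Pi.mul_apply, hadd, mul_assoc]

theorem exp_neg_mul_add (lam x y : ℝ) : ENNReal.ofReal (Real.exp (-lam * (x + y))) =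
    ENNReal.ofReal (Real.exp (-lam * x)) * ENNReal.ofReal (Real.exp (-lam * y)) := by
  rw [mul_add, Real.exp_add, ENNReal.ofReal_mul (Real.exp_pos _).le]

theorem killedLaw_tiltedLaw (ν : Measure ℝ) [IsFiniteMeasure ν] {S : Set ℝ}
    (hS : MeasurableSet S) (lam : ℝ) (n : ℕ) : killedLaw (tiltedLaw ν lam) S n =
      (killedLaw ν S n).withDensity fun x => ENNReal.ofReal (Real.exp (-lam * x)) := by
  induction n with
  | zero =>
    refine Measure.ext_of_lintegral _ fun f hf => ?_
    rw [killedLaw_zero, lintegral_withDensity_eq_lintegral_mul _ (by fun_prop) hf, killedLaw_zero,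
      lintegral_dirac' _ hf, lintegral_dirac' _ (by fun_prop)]
    simp
  | succ n ih =>
    rw [killedLaw_succ, killedLaw_succ, ih, tiltedLaw, withDensity_conv_withDensity _ _
      (by fun_prop) (exp_neg_mul_add lam) (fun _ => ENNReal.ofReal_ne_top),
      restrict_withDensity hS]

theorem lintegral_exitLaw_tiltedLaw (ν : Measure ℝ) [IsFiniteMeasure ν] {S : Set ℝ}
    (hS : MeasurableSet S) (lam : ℝ) {f : ℝ → ℝ≥0∞} (hf : Measurable f) :
    ∫⁻ x, f x ∂(exitLaw (tiltedLaw ν lam) S) =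
      ∫⁻ x, ENNReal.ofReal (Real.exp (-lam * x)) * f x ∂(exitLaw ν S) := by
  rw [exitLaw, exitLaw, lintegral_sum_measure, lintegral_sum_measure]
  refine tsum_congr fun n => ?_
  rw [exitLawAt, killedLaw_tiltedLaw ν hS, tiltedLaw, withDensity_conv_withDensity _ _
      (by fun_prop) (exp_neg_mul_add lam) (fun _ => ENNReal.ofReal_ne_top),
      restrict_withDensity hS.compl, lintegral_withDensity_eq_lintegral_mul _ (by fun_prop) hf]
  rfl

/-- Chebyshev's association inequality. -/
theorem lintegral_mul_lintegral_le (μ : Measure ℝ) [SFinite μ] {f g : ℝ → ℝ≥0∞}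
    (hf : Antitone f) (hg : Antitone g) :
    (∫⁻ x, f x ∂μ) * ∫⁻ x, g x ∂μ ≤ μ Set.univ * ∫⁻ x, f x * g x ∂μ := by
  have hfm := hf.measurable
  have hgm := hg.measurable
  refine (ENNReal.mul_le_mul_iff_right two_ne_zero ENNReal.ofNat_ne_top).1 ?_
  have h1 : ∫⁻ p : ℝ × ℝ, (f p.1 * g p.1 + f p.2 * g p.2) ∂(μ.prod μ) =
      2 * (μ Set.univ * ∫⁻ x, f x * g x ∂μ) := by
    rw [lintegral_add_left (by fun_prop), lintegral_prod _ (by fun_prop),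
      lintegral_prod _ (by fun_prop), two_mul]
    simp only [lintegral_const]
    rw [lintegral_mul_const _ (by fun_prop)]
    ring
  have h2 : ∫⁻ p : ℝ × ℝ, (f p.1 * g p.2 + f p.2 * g p.1) ∂(μ.prod μ) =
      2 * ((∫⁻ x, f x ∂μ) * ∫⁻ x, g x ∂μ) := by
    simp_rw [mul_comm (f _) (g _)]
    conv_lhs => arg 2; ext p; rw [mul_comm (g p.2)]
    rw [lintegral_add_left (by fun_prop), lintegral_prod_mul (by fun_prop) (by fun_prop),
      lintegral_prod_mul (by fun_prop) (by fun_prop)]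
    ring
  rw [← h1, ← h2]
  refine lintegral_mono fun p => ?_
  -- The rearrangement inequality; the gap between the sides is u * v, which avoids subtraction in
  -- `ℝ≥0∞`.
  have key {a b c d : ℝ≥0∞} (h1 : a ≤ b) (h2 : c ≤ d) : a * d + b * c ≤ a * c + b * d := by
    obtain ⟨u, rfl⟩ := exists_add_of_le h1
    obtain ⟨v, rfl⟩ := exists_add_of_le h2
    calc a * (c + v) + (a + u) * c ≤ a * (c + v) + (a + u) * c + u * v := le_self_add
      _ = a * c + (a + u) * (c + v) := by ring
  rcases le_total p.1 p.2 with h | h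
  · rw [add_comm, add_comm (f p.1 * g p.1)]
    exact key (hf h) (hg h)
  · exact key (hf h) (hg h)

/-! ### The exit law of a walk with independent identically distributed increments -/

section Walk

variable {Ω : Type*}

/-- The event that the walk stays in `S` up to time `n`. -/
def stayEvent (X : ℕ → Ω → ℝ) (S : Set ℝ) (n : ℕ) : Set Ω :=
  {ω | ∀ k, 1 ≤ k → k ≤ n → walk X k ω ∈ S}

theorem walk_succ (X : ℕ → Ω → ℝ) (n : ℕ) (ω : Ω) :
    walk X (n + 1) ω = walk X n ω + X n ω := Finset.sum_range_succ _ _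

theorem measurable_walk [MeasurableSpace Ω] {X : ℕ → Ω → ℝ} (hX : ∀ k, Measurable (X k)) (n : ℕ) :
    Measurable (walk X n) := by
  unfold walk
  fun_prop

theorem measurableSet_stayEvent [MeasurableSpace Ω] {X : ℕ → Ω → ℝ} (hX : ∀ k, Measurable (X k)) {S : Set ℝ}
    (hS : MeasurableSet S) (n : ℕ) : MeasurableSet (stayEvent X S n) := by
  have : stayEvent X S n = ⋂ k, ⋂ (_ : 1 ≤ k), ⋂ (_ : k ≤ n), walk X k ⁻¹' S := by
    ext ω; simp [stayEvent]
  rw [this]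
  exact MeasurableSet.iInter fun k => MeasurableSet.iInter fun _ => MeasurableSet.iInter fun _ =>
    measurable_walk hX k hS

theorem stayEvent_succ (X : ℕ → Ω → ℝ) (S : Set ℝ) (n : ℕ) :
    stayEvent X S (n + 1) = stayEvent X S n ∩ walk X (n + 1) ⁻¹' S := by
  ext ω
  constructor
  · exact fun h => ⟨fun k h1 h2 => h k h1 (by omega), h _ (by omega) le_rfl⟩
  · rintro ⟨h1, h2⟩ k hk hkn
    rcases Nat.lt_or_ge k (n + 1) with h | h
    · exact h1 k hk (by omega)
    · rw [show k = n + 1 by omega]; exact h2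

/-- The first `n` increments, extended by zero. -/
def truncatedIncr (n : ℕ) (j : ℕ) (z : Finset.range n → ℝ) : ℝ :=
  if h : j ∈ Finset.range n then z ⟨j, h⟩ else 0

theorem measurable_truncatedIncr (n j : ℕ) : Measurable (truncatedIncr n j) := by
  unfold truncatedIncr
  split_ifs
  · fun_prop
  · fun_prop

theorem walk_truncatedIncr (X : ℕ → Ω → ℝ) {n k : ℕ} (hk : k ≤ n) (ω : Ω) :
    walk (truncatedIncr n) k (fun i => X i ω) = walk X k ω := by
  refine Finset.sum_congr rfl fun j hj => ?_
  have : j ∈ Finset.range n := Finset.mem_range.2 ((Finset.mem_range.1 hj).trans_le hk)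
  rw [truncatedIncr, dif_pos this]

theorem exitTime_eq {X : ℕ → Ω → ℝ} {A B : ℝ} {n : ℕ} {ω : Ω} (hω : ω ∈ stayEvent X (Set.Icc (-B) A) n)
    (hn : walk X (n + 1) ω ∉ Set.Icc (-B) A) : exitTime X A B ω = WithTop.some (n + 1) := by
  refine le_antisymm (hittingAfter_le_of_mem (Nat.le_add_left 1 n) hn) ?_
  by_contra h
  obtain ⟨j, hj, hj'⟩ := hittingAfter_lt_iff.1 (not_le.1 h)
  exact hj' (hω j hj.1 (Nat.lt_succ_iff.1 hj.2))

theorem exitPosition_eq {X : ℕ → Ω → ℝ} {A B : ℝ} {n : ℕ} {ω : Ω} (hω : ω ∈ stayEvent X (Set.Icc (-B) A) n)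
    (hn : walk X (n + 1) ω ∉ Set.Icc (-B) A) : exitPosition X A B ω = walk X (n + 1) ω := by
  rw [exitPosition, stoppedValue, exitTime_eq hω hn]
  rfl

theorem exitEvent_eq (X : ℕ → Ω → ℝ) {A B : ℝ} {U : Set ℝ} (hU : Disjoint U (Set.Icc (-B) A)) :
    {ω | exitTime X A B ω ≠ ⊤ ∧ exitPosition X A B ω ∈ U} =
      ⋃ n, stayEvent X (Set.Icc (-B) A) n ∩ walk X (n + 1) ⁻¹' U := by
  ext ω
  simp only [Set.mem_ofPred_eq, Set.mem_iUnion]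
  constructor
  · rintro ⟨h1, h2⟩
    obtain ⟨m, hm⟩ := WithTop.ne_top_iff_exists.1 h1
    have hm1 : 1 ≤ m := by
      have := le_hittingAfter (u := walk X) (s := (Set.Icc (-B) A)ᶜ) (n := 1) ω
      rw [show hittingAfter (walk X) (Set.Icc (-B) A)ᶜ 1 ω = m from hm.symm] at this
      exact WithTop.coe_le_coe.1 this
    obtain ⟨n, rfl⟩ : ∃ n, m = n + 1 := ⟨m - 1, by omega⟩
    have hpos : exitPosition X A B ω = walk X (n + 1) ω := by
      rw [exitPosition, stoppedValue, ← hm]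
      rfl
    refine ⟨n, fun k hk hkn => ?_, by rwa [Set.mem_preimage, ← hpos]⟩
    have hlt : WithTop.some k < hittingAfter (walk X) (Set.Icc (-B) A)ᶜ 1 ω := by
      rw [show hittingAfter (walk X) (Set.Icc (-B) A)ᶜ 1 ω = _ from hm.symm]
      exact WithTop.coe_lt_coe.2 (Nat.lt_succ_of_le hkn)
    simpa using notMem_of_lt_hittingAfter hlt hk
  · rintro ⟨n, h1, h2⟩
    have hn := Set.disjoint_left.1 hU h2
    refine ⟨?_, ?_⟩
    · rw [exitTime_eq h1 hn]; exact WithTop.coe_ne_top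
    · rw [exitPosition_eq h1 hn]; exact h2

variable [MeasurableSpace Ω] {P : Measure Ω} [IsProbabilityMeasure P] {X : ℕ → Ω → ℝ} {ν : Measure ℝ}

/-- The stay event and S_n are functions of the first n increments, made explicit by
`truncatedIncr`, and these are independent of `X n`, the increment number n + 1. -/
theorem setLIntegral_stayEvent_succ (hX : ∀ k, Measurable (X k)) (hindep : iIndepFun X P)
    {S : Set ℝ} (hS : MeasurableSet S) (n : ℕ) {f : ℝ → ℝ≥0∞} (hf : Measurable f) :
    ∫⁻ ω in stayEvent X S n, f (walk X (n + 1) ω) ∂P =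
      ∫⁻ ω in stayEvent X S n, ∫⁻ y, f (walk X n ω + y) ∂(P.map (X n)) ∂P := by
  set Z : Ω → (Finset.range n → ℝ) := fun ω i => X i ω with hZdef
  have hZ : Measurable Z := by fun_prop
  have hind : IndepFun Z (X n) P :=
    (hindep.indepFun_finset (Finset.range n) {n} (by simp) hX).comp measurable_id
      (measurable_pi_apply (⟨n, Finset.mem_singleton_self n⟩ : ({n} : Finset ℕ)))
  have hmap := (indepFun_iff_map_prod_eq_prod_map_map hZ.aemeasurable (hX n).aemeasurable).1 hind
  set T : Set (Finset.range n → ℝ) := stayEvent (truncatedIncr n) S n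
  have hT : MeasurableSet T := measurableSet_stayEvent (measurable_truncatedIncr n) hS n
  have hTZ : Z ⁻¹' T = stayEvent X S n := by
    ext ω
    refine forall_congr' fun k => forall_congr' fun _ => forall_congr' fun hk => ?_
    rw [hZdef, walk_truncatedIncr X hk]
  have hwZ (ω : Ω) : walk (truncatedIncr n) n (Z ω) = walk X n ω := walk_truncatedIncr X le_rfl ω
  have hw : Measurable (walk (truncatedIncr n) n) :=
    measurable_walk (measurable_truncatedIncr n) n
  have hg : Measurable fun p : (Finset.range n → ℝ) × ℝ =>
      T.indicator (fun _ => (1 : ℝ≥0∞)) p.1 * f (walk (truncatedIncr n) n p.1 + p.2) :=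
    ((measurable_const.indicator hT).comp measurable_fst).mul
      (hf.comp ((hw.comp measurable_fst).add measurable_snd))
  have := Measure.isProbabilityMeasure_map (hX n).aemeasurable (μ := P)
  have h := lintegral_map hg (hZ.prodMk (hX n)) (μ := P)
  rw [hmap, lintegral_prod _ hg.aemeasurable, lintegral_map (by
    exact hg.lintegral_prod_right') hZ] at h
  have hset : MeasurableSet (stayEvent X S n) := measurableSet_stayEvent hX hS n
  rw [← lintegral_indicator hset, ← lintegral_indicator hset]
  refine Eq.trans (lintegral_congr fun ω => ?_) (h.symm.trans (lintegral_congr fun ω => ?_))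
  · rw [hwZ]
    by_cases hω : ω ∈ stayEvent X S n
    · rw [Set.indicator_of_mem hω, Set.indicator_of_mem (by rwa [← hTZ] at hω), one_mul,
        walk_succ]
    · rw [Set.indicator_of_notMem hω, Set.indicator_of_notMem (by rwa [← hTZ] at hω), zero_mul]
  · simp only [hwZ]
    by_cases hω : ω ∈ stayEvent X S n
    · rw [Set.indicator_of_mem hω, Set.indicator_of_mem (by rwa [← hTZ] at hω)]
      simp
    · rw [Set.indicator_of_notMem hω, Set.indicator_of_notMem (by rwa [← hTZ] at hω)]
      simp

theorem setLIntegral_stayEvent (hX : ∀ k, Measurable (X k)) (hindep : iIndepFun X P)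
    (hlaw : ∀ k, P.map (X k) = ν) [IsProbabilityMeasure ν] {S : Set ℝ} (hS : MeasurableSet S)
    (n : ℕ) {f : ℝ → ℝ≥0∞} (hf : Measurable f) :
    ∫⁻ ω in stayEvent X S n, f (walk X n ω) ∂P = ∫⁻ x, f x ∂(killedLaw ν S n) := by
  induction n generalizing f with
  | zero =>
    have : stayEvent X S 0 = Set.univ :=
      Set.eq_univ_of_forall fun ω k h1 h2 => absurd h1 (by omega)
    rw [this, killedLaw_zero, lintegral_dirac' _ hf]
    simp [walk]
  | succ n ih =>
    have hm := measurable_walk hX (n + 1) hS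
    rw [stayEvent_succ, Set.inter_comm, ← Measure.restrict_restrict hm, ← lintegral_indicator hm,
      killedLaw_succ, ← lintegral_indicator hS, Measure.lintegral_conv (hf.indicator hS)]
    have h := setLIntegral_stayEvent_succ hX hindep hS n (hf.indicator hS)
    rw [hlaw, ih (f := fun x => ∫⁻ y, S.indicator f (x + y) ∂ν) (by
      have := hf.indicator hS
      fun_prop)] at h
    exact h

/-- The law of the exit position of a walk. -/
theorem setLIntegral_exitPosition (hX : ∀ k, Measurable (X k)) (hindep : iIndepFun X P)
    (hlaw : ∀ k, P.map (X k) = ν) [IsProbabilityMeasure ν] {A B : ℝ} {U : Set ℝ}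
    (hUm : MeasurableSet U) (hU : Disjoint U (Set.Icc (-B) A)) {f : ℝ → ℝ≥0∞}
    (hf : Measurable f) :
    ∫⁻ ω in {ω | exitTime X A B ω ≠ ⊤ ∧ exitPosition X A B ω ∈ U}, f (exitPosition X A B ω) ∂P =
      ∫⁻ x in U, f x ∂(exitLaw ν (Set.Icc (-B) A)) := by
  have hI : MeasurableSet (Set.Icc (-B) A) := measurableSet_Icc
  have hset (n : ℕ) : MeasurableSet (stayEvent X (Set.Icc (-B) A) n ∩ walk X (n + 1) ⁻¹' U) :=
    (measurableSet_stayEvent hX hI n).inter (measurable_walk hX (n + 1) hUm)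
  have hdisj : Pairwise (Function.onFun Disjoint
      fun n => stayEvent X (Set.Icc (-B) A) n ∩ walk X (n + 1) ⁻¹' U) := by
    intro m n hmn
    refine Set.disjoint_left.2 fun ω h1 h2 => hmn ?_
    have e1 := exitTime_eq h1.1 (Set.disjoint_left.1 hU h1.2)
    have e2 := exitTime_eq h2.1 (Set.disjoint_left.1 hU h2.2)
    have := e1.symm.trans e2
    have := WithTop.coe_injective this
    omega
  rw [exitEvent_eq X hU, lintegral_iUnion hset hdisj, exitLaw,
    Measure.restrict_sum _ hUm, lintegral_sum_measure]
  refine tsum_congr fun n => ?_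
  rw [exitLawAt, Measure.restrict_restrict hUm, Set.inter_eq_left.2 hU.subset_compl_right,
    ← lintegral_indicator hUm, Measure.lintegral_conv (hf.indicator hUm)]
  have h := setLIntegral_stayEvent_succ hX hindep hI n (hf.indicator hUm)
  rw [hlaw, setLIntegral_stayEvent hX hindep hlaw hI n
    (f := fun x => ∫⁻ y, U.indicator f (x + y) ∂ν) (by
      have := hf.indicator hUm
      fun_prop)] at h
  have hm := measurable_walk hX (n + 1) hUm
  rw [← h, setLIntegral_congr_fun (hset n) (g := fun ω => f (walk X (n + 1) ω))
    (fun ω hω => by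
      show f (exitPosition X A B ω) = _
      rw [exitPosition_eq hω.1 (Set.disjoint_left.1 hU hω.2)]),
    Set.inter_comm, ← Measure.restrict_restrict hm, ← lintegral_indicator hm]
  rfl

end Walk

/-! ### Conditional mean overshoots -/

theorem condMean_eq {Ω : Type*} [MeasurableSpace Ω] (P : Measure Ω) (D : Ω → ℝ) (E : Set Ω) :
    condMean P D E = (P E)⁻¹ * ∫⁻ ω in E, ENNReal.ofReal (D ω) ∂P := by
  rw [condMean, ProbabilityTheory.cond, lintegral_smul_measure, smul_eq_mul]

section CondMean

variable {Ω : Type*} [MeasurableSpace Ω] {P : Measure Ω} [IsProbabilityMeasure P]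
  {X : ℕ → Ω → ℝ} {ν : Measure ℝ} [IsProbabilityMeasure ν]

theorem disjoint_Ioi_Icc (A B : ℝ) : Disjoint (Set.Ioi A) (Set.Icc (-B) A) :=
  Set.disjoint_left.2 fun _ hx hx' => not_le.2 (Set.mem_Ioi.1 hx) hx'.2

theorem disjoint_Iio_Icc (A B : ℝ) : Disjoint (Set.Iio (-B)) (Set.Icc (-B) A) :=
  Set.disjoint_left.2 fun _ hx hx' => not_le.2 (Set.mem_Iio.1 hx) hx'.1

theorem measure_upperExit (hX : ∀ k, Measurable (X k)) (hindep : iIndepFun X P)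
    (hlaw : ∀ k, P.map (X k) = ν) (A B : ℝ) :
    P (upperExit X A B) = exitLaw ν (Set.Icc (-B) A) (Set.Ioi A) := by
  have h := setLIntegral_exitPosition hX hindep hlaw measurableSet_Ioi (disjoint_Ioi_Icc A B)
    (measurable_const (a := (1 : ℝ≥0∞)))
  rwa [setLIntegral_one, setLIntegral_one] at h

theorem measure_lowerExit (hX : ∀ k, Measurable (X k)) (hindep : iIndepFun X P)
    (hlaw : ∀ k, P.map (X k) = ν) (A B : ℝ) :
    P (lowerExit X A B) = exitLaw ν (Set.Icc (-B) A) (Set.Iio (-B)) := by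
  have h := setLIntegral_exitPosition hX hindep hlaw measurableSet_Iio (disjoint_Iio_Icc A B)
    (measurable_const (a := (1 : ℝ≥0∞)))
  rwa [setLIntegral_one, setLIntegral_one] at h

theorem condMean_upperExit (hX : ∀ k, Measurable (X k)) (hindep : iIndepFun X P)
    (hlaw : ∀ k, P.map (X k) = ν) (A B : ℝ) :
    condMean P (upperOvershoot X A B) (upperExit X A B) = (P (upperExit X A B))⁻¹ *
      ∫⁻ y in Set.Ioi A, ENNReal.ofReal (y - A) ∂(exitLaw ν (Set.Icc (-B) A)) := by
  rw [condMean_eq]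
  exact congrArg _ (setLIntegral_exitPosition hX hindep hlaw measurableSet_Ioi
    (disjoint_Ioi_Icc A B) (f := fun y => ENNReal.ofReal (y - A)) (by fun_prop))

theorem condMean_lowerExit (hX : ∀ k, Measurable (X k)) (hindep : iIndepFun X P)
    (hlaw : ∀ k, P.map (X k) = ν) (A B : ℝ) :
    condMean P (lowerOvershoot X A B) (lowerExit X A B) = (P (lowerExit X A B))⁻¹ *
      ∫⁻ y in Set.Iio (-B), ENNReal.ofReal (-(y + B)) ∂(exitLaw ν (Set.Icc (-B) A)) := by
  rw [condMean_eq]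
  exact congrArg _ (setLIntegral_exitPosition hX hindep hlaw measurableSet_Iio
    (disjoint_Iio_Icc A B) (f := fun y => ENNReal.ofReal (-(y + B))) (by fun_prop))

end CondMean

/-! ### Drift reversal and overshoot comparison under tilting -/

theorem integrable_id_of_cube {ν : Measure ℝ} [IsFiniteMeasure ν]
    (h : Integrable (fun y => |y| ^ 3) ν) : Integrable (fun y => y) ν := by
  refine ((integrable_const (1 : ℝ)).add h).mono' (by fun_prop) (ae_of_all _ fun y => ?_)
  rw [Real.norm_eq_abs, Pi.add_apply]
  rcases le_total |y| 1 with h1 | h1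
  · exact h1.trans (le_add_of_nonneg_right (by positivity))
  · exact (le_self_pow₀ h1 three_ne_zero).trans (le_add_of_nonneg_left zero_le_one)

theorem isProbabilityMeasure_tiltedLaw {ν : Measure ℝ} {lam : ℝ}
    (h : ∫ x, Real.exp (-lam * x) ∂ν = 1) : IsProbabilityMeasure (tiltedLaw ν lam) := by
  constructor
  rw [tiltedLaw, withDensity_apply _ MeasurableSet.univ, Measure.restrict_univ,
    ← ofReal_integral_eq_lintegral_ofReal (integrable_of_integral_eq_one h)
      (ae_of_all _ fun x => (Real.exp_pos _).le), h, ENNReal.ofReal_one]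

/-- Under the tilted law the drift is reversed. -/
theorem integral_tiltedLaw_neg {ν : Measure ℝ} [IsProbabilityMeasure ν] {lam : ℝ}
    (hlam : 0 < lam) (h : ∫ x, Real.exp (-lam * x) ∂ν = 1) (hpos : 0 < ∫ y, y ∂ν)
    (hint : Integrable (fun y => y) (tiltedLaw ν lam)) : ∫ y, y ∂(tiltedLaw ν lam) < 0 := by
  have := isProbabilityMeasure_tiltedLaw h
  have h1 : ∫⁻ x, ENNReal.ofReal (Real.exp (lam * x)) ∂(tiltedLaw ν lam) = 1 := by
    rw [tiltedLaw, lintegral_withDensity_eq_lintegral_mul _ (by fun_prop) (by fun_prop)]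
    have (x : ℝ) : ((fun x => ENNReal.ofReal (Real.exp (-lam * x))) *
        fun x => ENNReal.ofReal (Real.exp (lam * x))) x = 1 := by
      rw [Pi.mul_apply, ← ENNReal.ofReal_mul (Real.exp_pos _).le, ← Real.exp_add]
      simp
    simp_rw [this]
    simp
  have h2 : Integrable (fun x => Real.exp (lam * x)) (tiltedLaw ν lam) := by
    refine ⟨by fun_prop, ?_⟩
    rw [hasFiniteIntegral_iff_ofReal (ae_of_all _ fun x => (Real.exp_pos _).le), h1]
    exact ENNReal.one_lt_top
  have h3 : ∫ x, Real.exp (lam * x) ∂(tiltedLaw ν lam) = 1 := by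
    rw [integral_eq_lintegral_of_nonneg_ae (ae_of_all _ fun x => (Real.exp_pos _).le)
      (by fun_prop), h1, ENNReal.toReal_one]
  have h2' : Integrable (fun x => Real.exp (lam * x) - 1) (tiltedLaw ν lam) :=
    h2.sub (integrable_const 1)
  have h4 : Integrable (fun x => Real.exp (lam * x) - 1 - lam * x) (tiltedLaw ν lam) :=
    h2'.sub (hint.const_mul lam)
  have h5 : ∫ x, (Real.exp (lam * x) - 1 - lam * x) ∂(tiltedLaw ν lam) =
      -(lam * ∫ y, y ∂(tiltedLaw ν lam)) := by
    rw [integral_sub h2' (hint.const_mul lam),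
      integral_sub h2 (integrable_const 1), h3, integral_const, probReal_univ, one_smul,
      integral_const_mul]
    ring
  -- Under the tilted law e^{λX} has mean 1, so e^u ≥ 1 + u forces a nonpositive mean. Mean zero
  -- would force X = 0 almost surely, also under `ν`, against the positive drift.
  have h6 : ∀ x : ℝ, 0 ≤ Real.exp (lam * x) - 1 - lam * x := fun x => by
    linarith [Real.add_one_le_exp (lam * x)]
  by_contra hcon
  have h7 : ∫ x, (Real.exp (lam * x) - 1 - lam * x) ∂(tiltedLaw ν lam) = 0 := by
    refine le_antisymm ?_ (integral_nonneg h6)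
    rw [h5]
    nlinarith [not_lt.1 hcon]
  rw [integral_eq_zero_iff_of_nonneg h6 h4] at h7
  have hac : ν ≪ tiltedLaw ν lam := withDensity_absolutelyContinuous' (by fun_prop)
    (ae_of_all _ fun x => (ENNReal.ofReal_pos.2 (Real.exp_pos _)).ne')
  refine hpos.ne' (integral_eq_zero_of_ae ?_)
  filter_upwards [hac.ae_le h7] with x hx
  by_contra hne
  have := Real.add_one_lt_exp (mul_ne_zero hlam.ne' hne)
  simp only [Pi.zero_apply] at hx
  linarith

theorem exitLaw_tiltedLaw_Iio (ν : Measure ℝ) [IsFiniteMeasure ν] (lam A B : ℝ) :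
    exitLaw (tiltedLaw ν lam) (Set.Icc (-B) A) (Set.Iio (-B)) =
      ∫⁻ x in Set.Iio (-B), ENNReal.ofReal (Real.exp (-lam * x))
        ∂(exitLaw ν (Set.Icc (-B) A)) := by
  rw [← lintegral_indicator_one measurableSet_Iio, lintegral_exitLaw_tiltedLaw ν measurableSet_Icc
    lam (measurable_one.indicator measurableSet_Iio), ← lintegral_indicator measurableSet_Iio]
  refine lintegral_congr fun x => ?_
  by_cases hx : x ∈ Set.Iio (-B)
  · rw [Set.indicator_of_mem hx, Set.indicator_of_mem hx, Pi.one_apply, mul_one]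
  · rw [Set.indicator_of_notMem hx, Set.indicator_of_notMem hx, mul_zero]

/-- Passing to the tilted law increases the conditional mean of the lower overshoot. -/
theorem lintegral_lowerOvershoot_mul_le (ν : Measure ℝ) [IsFiniteMeasure ν] {lam : ℝ}
    (hlam : 0 < lam) (A B : ℝ) :
    (∫⁻ y in Set.Iio (-B), ENNReal.ofReal (-(y + B)) ∂(exitLaw ν (Set.Icc (-B) A))) *
        exitLaw (tiltedLaw ν lam) (Set.Icc (-B) A) (Set.Iio (-B)) ≤
      exitLaw ν (Set.Icc (-B) A) (Set.Iio (-B)) *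
        ∫⁻ y, ENNReal.ofReal (-(y + B)) ∂(exitLaw (tiltedLaw ν lam) (Set.Icc (-B) A)) := by
  have h := lintegral_mul_lintegral_le ((exitLaw ν (Set.Icc (-B) A)).restrict (Set.Iio (-B)))
    (f := fun y => ENNReal.ofReal (-(y + B))) (g := fun x => ENNReal.ofReal (Real.exp (-lam * x)))
    (fun x y hxy => ENNReal.ofReal_le_ofReal (by linarith))
    (fun x y hxy => ENNReal.ofReal_le_ofReal (Real.exp_le_exp.2 (by nlinarith)))
  rw [Measure.restrict_apply_univ] at h
  rw [exitLaw_tiltedLaw_Iio, lintegral_exitLaw_tiltedLaw ν measurableSet_Icc lam (by fun_prop)]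
  refine h.trans (mul_le_mul_right ((setLIntegral_le_lintegral _ _).trans_eq ?_) _)
  exact lintegral_congr fun y => mul_comm _ _

/-- Reflection makes the drift positive and exchanges the roles of A and B. -/
theorem lintegral_exitLaw_le_overshootParam_neg (ν : Measure ℝ) [IsProbabilityMeasure ν]
    {A B : ℝ} (hA : 0 ≤ A) (hB : 0 ≤ B) (hneg : ∫ y, y ∂ν < 0)
    (h3 : Integrable (fun y => |y| ^ 3) ν) :
    ∫⁻ y, ENNReal.ofReal (-(y + B)) ∂(exitLaw ν (Set.Icc (-B) A)) ≤
      overshootParam (ν.map fun x => -x) := by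
  have := Measure.isProbabilityMeasure_map (μ := ν) (f := fun x : ℝ => -x) (by fun_prop)
  have h3' : Integrable (fun y => |y| ^ 3) (ν.map fun x => -x) := by
    rw [integrable_map_measure (by fun_prop) (by fun_prop)]
    simpa [Function.comp_def] using h3
  have hpos : 0 < ∫ y, y ∂(ν.map fun x => -x) := by
    rw [integral_map (by fun_prop) (by fun_prop), integral_neg]
    linarith
  have h := lintegral_exitLaw_le_overshootParam (ν.map fun x => -x) hB hA
    (integrable_id_of_cube h3') hpos h3'
  have hset : Set.Icc (-A) B = (fun x : ℝ => -x) ⁻¹' Set.Icc (-B) A := by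
    ext x
    simp only [Set.mem_preimage, Set.mem_Icc]
    constructor <;> rintro ⟨h1, h2⟩ <;> constructor <;> linarith
  rw [hset, lintegral_exitLaw_map_neg ν measurableSet_Icc (by fun_prop)] at h
  simpa only [neg_add, sub_eq_add_neg] using h

end TwoSidedExit

end

/-! ### Proof of the two-sided exit theorem -/

theorem mainTheorem4 {Ω : Type*} [MeasurableSpace Ω] (P : Measure Ω) [IsProbabilityMeasure P]
    (X : ℕ → Ω → ℝ) (hmeas : ∀ k, Measurable (X k)) (hindep : iIndepFun X P)
    (hident : ∀ k, IdentDistrib (X k) (X 0) P P)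
    (hint : Integrable (X 0) P) (hmean : 0 < ∫ ω, X 0 ω ∂P)
    (hneg : 0 < P {ω | X 0 ω < 0})
    (A B : ℝ) (hA : 0 ≤ A) (hB : 0 ≤ B) :
    (Integrable (fun ω => |X 0 ω| ^ 3) P →
      0 < P (TwoSidedExit.upperExit X A B) ∧
      TwoSidedExit.condMean P (TwoSidedExit.upperOvershoot X A B)
          (TwoSidedExit.upperExit X A B) ≤
        TwoSidedExit.overshootParam (P.map (X 0)) / P (TwoSidedExit.upperExit X A B) ∧
      TwoSidedExit.condMean P (TwoSidedExit.upperOvershoot X A B)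
          (TwoSidedExit.upperExit X A B) ≤
        TwoSidedExit.posMeanExcess (P.map (X 0))) ∧
    (∀ lam : ℝ, 0 < lam →
      ∫ ω, Real.exp (-lam * X 0 ω) ∂P = 1 →
      Integrable (fun x : ℝ => |x| ^ 3) (TwoSidedExit.tiltedLaw (P.map (X 0)) lam) →
      0 < TwoSidedExit.tiltedPathMeasure (P.map (X 0)) lam
          (TwoSidedExit.lowerExit TwoSidedExit.coordIncr A B) →
      0 < P (TwoSidedExit.lowerExit X A B) ∧
      TwoSidedExit.condMean P (TwoSidedExit.lowerOvershoot X A B)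
          (TwoSidedExit.lowerExit X A B) ≤
        TwoSidedExit.overshootParam
            ((TwoSidedExit.tiltedLaw (P.map (X 0)) lam).map (fun x => -x)) /
          TwoSidedExit.tiltedPathMeasure (P.map (X 0)) lam
            (TwoSidedExit.lowerExit TwoSidedExit.coordIncr A B) ∧
      TwoSidedExit.condMean P (TwoSidedExit.lowerOvershoot X A B)
          (TwoSidedExit.lowerExit X A B) ≤
        TwoSidedExit.negMeanExcess (P.map (X 0))) := by
  have hlaw : ∀ k, P.map (X k) = P.map (X 0) := fun k => (hident k).map_eq
  have hν : IsProbabilityMeasure (P.map (X 0)) :=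
    Measure.isProbabilityMeasure_map (hmeas 0).aemeasurable
  have hpos : 0 < ∫ y, y ∂(P.map (X 0)) := by
    rwa [integral_map (hmeas 0).aemeasurable (by fun_prop)]
  have hint' : Integrable (fun y => y) (P.map (X 0)) :=
    (integrable_map_measure (by fun_prop) (hmeas 0).aemeasurable).2 hint
  set ν := P.map (X 0)
  refine ⟨fun h3 => ?_, fun lam hlam hexp h3 hp => ?_⟩
  · have h3' : Integrable (fun y => |y| ^ 3) ν :=
      (integrable_map_measure (by fun_prop) (hmeas 0).aemeasurable).2 h3
    have hp : 0 < P (TwoSidedExit.upperExit X A B) := by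
      rw [TwoSidedExit.measure_upperExit hmeas hindep hlaw]
      exact TwoSidedExit.exitLaw_Ioi_pos ν hB hpos
    rw [TwoSidedExit.condMean_upperExit hmeas hindep hlaw]
    refine ⟨hp, ?_, ?_⟩
    · rw [ENNReal.div_eq_inv_mul]
      exact mul_le_mul_right ((setLIntegral_le_lintegral _ _).trans
        (TwoSidedExit.lintegral_exitLaw_le_overshootParam ν hA hB hint' hpos h3')) _
    · refine (mul_le_mul_right ((setLIntegral_le_lintegral _ _).trans
        (TwoSidedExit.lintegral_exitLaw_le_posMeanExcess ν hA hB)) _).trans ?_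
      rw [← TwoSidedExit.measure_upperExit hmeas hindep hlaw, mul_left_comm,
        ENNReal.inv_mul_cancel hp.ne' (measure_ne_top _ _), mul_one]
  · have hexp' : ∫ x, Real.exp (-lam * x) ∂ν = 1 := by
      rw [← hexp]
      exact integral_map (hmeas 0).aemeasurable (by fun_prop)
    have htilt : IsProbabilityMeasure (TwoSidedExit.tiltedLaw ν lam) :=
      TwoSidedExit.isProbabilityMeasure_tiltedLaw hexp'
    have hpath : IsProbabilityMeasure (TwoSidedExit.tiltedPathMeasure ν lam) := by
      unfold TwoSidedExit.tiltedPathMeasure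
      infer_instance
    have hpbar : TwoSidedExit.tiltedPathMeasure ν lam
        (TwoSidedExit.lowerExit TwoSidedExit.coordIncr A B) =
        TwoSidedExit.exitLaw (TwoSidedExit.tiltedLaw ν lam) (Set.Icc (-B) A) (Set.Iio (-B)) :=
      TwoSidedExit.measure_lowerExit (fun k => measurable_pi_apply k)
        (iIndepFun_infinitePi (P := fun _ : ℕ => TwoSidedExit.tiltedLaw ν lam)
          (X := fun _ x => x) fun _ => measurable_id)
        (fun k => Measure.infinitePi_map_eval _ k) A B
    have hplow := TwoSidedExit.measure_lowerExit hmeas hindep hlaw A B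
    have hq : 0 < P (TwoSidedExit.lowerExit X A B) := by
      rw [hplow, pos_iff_ne_zero]
      -- The tilted exit law has a density with respect to the original one, so a null lower exit
      -- would remain null after tilting.
      intro h0
      rw [hpbar, TwoSidedExit.exitLaw_tiltedLaw_Iio, Measure.restrict_eq_zero.2 h0,
        lintegral_zero_measure] at hp
      exact hp.ne' rfl
    rw [TwoSidedExit.condMean_lowerExit hmeas hindep hlaw]
    refine ⟨hq, ?_, ?_⟩
    · rw [ENNReal.le_div_iff_mul_le (Or.inl hp.ne') (Or.inl (measure_ne_top _ _)), mul_assoc, hpbar]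
      -- The association inequality trades the factor p̄₋ for p₋, which cancels the normalization of
      -- the conditional mean.
      refine (mul_le_mul_right (TwoSidedExit.lintegral_lowerOvershoot_mul_le ν hlam A B) _).trans ?_
      rw [← hplow, ← mul_assoc, ENNReal.inv_mul_cancel hq.ne' (measure_ne_top _ _), one_mul]
      exact TwoSidedExit.lintegral_exitLaw_le_overshootParam_neg _ hA hB
        (TwoSidedExit.integral_tiltedLaw_neg hlam hexp' hpos
          (TwoSidedExit.integrable_id_of_cube h3)) h3
    · refine (mul_le_mul_right ((setLIntegral_le_lintegral _ _).trans
        (TwoSidedExit.lintegral_exitLaw_le_negMeanExcess ν hA hB)) _).trans ?_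
      rw [← hplow, mul_left_comm, ENNReal.inv_mul_cancel hq.ne' (measure_ne_top _ _), mul_one]
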